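/- Let $\Omega\subset\mathbb{R}^d$ be a bounded convex open set. Let $\rho_1,\rho_2\in BV(\Omega;\{0,1\})$, i.e. $\rho_i\in L^1(\Omega)$, $\rho_i\in\{0,1\}$ a.e. in $\Omega$, and the distributional gradient $D\rho_i$ is a finite $\mathbb{R}^d$-valued Radon measure on $\Omega$; suppose that $\rho_1\rho_2=0$ a.e. in $\Omega$. Let $\zeta:\Omega\to\mathbb{R}$ be smooth and bounded. Let $J:\mathbb{R}^d\to\mathbb{R}$ be a (measurable) nonnegative even kernel with rapid decay, i.e. $J(z)\le |P(z)|\,G(z)$ for some polynomial $P$, where $G(z)=(4\pi)^{-d/2}e^{-|z|^2/4}$. For $\varepsilon>0$ put $J_\varepsilon(z):=\varepsilon^{-(d+1)}J(z/\varepsilon)$ and $$(J_\varepsilon\star\rho_2)(x):=\int_{\mathbb{R}^d}J_\varepsilon(z)\,\rho_2(x-z)\,dz,$$ where $\rho_2$ is extended by $0$ outside $\Omega$. For a finite $\mathbb{R}^d$-valued Radon measure $\nu$ on $\Omega$, with total variation $|\nu|$ and Radon–Nikodym density $\frac{\nu}{|\nu|}$, let $\sigma_J(\nu)$ be the measure on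 $\Omega$ given by $$\int_\Omega\psi\,d\sigma_J(\nu)=\int_{\mathbb{R}^d}J(z)\int_\Omega\psi(x)\,\Big|z\cdot\frac{\nu}{|\nu|}(x)\Big|\,d|\nu|(x)\,dz$$ for all bounded continuous $\psi:\Omega\to\mathbb{R}$. Then $$\lim_{\varepsilon\downarrow0}\int_\Omega\zeta\,\rho_1\,(J_\varepsilon\star\rho_2)\,dx=\frac14\Big[\int_\Omega\zeta\,d\sigma_J(D\rho_1)+\int_\Omega\zeta\,d\sigma_J(D\rho_2)\Big]-\frac14\int_\Omega\zeta\,d\sigma_J(D(\rho_1+\rho_2)).$$ -/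

import Mathlib

open MeasureTheory Set Filter Topology
open scoped ContDiff

/-- Euclidean space `ℝ^d`. -/
abbrev Space (d : ℕ) : Type := EuclideanSpace ℝ (Fin d)

/-! ### Functions of bounded variation on an open set -/

/-- The finite `ℝ^d`-valued Borel measure `ν` on `Ω` (regarded as a measure on `ℝ^d` that is
concentrated on `Ω`) is the distributional gradient of `ρ` in `Ω`:
`∫_Ω ρ ∇φ dx = - ∫_Ω φ dν` for every test function `φ ∈ C_c^∞(Ω)`. -/
def IsGradientMeasure {d : ℕ} (Ω : Set (Space d)) (ρ : Space d → ℝ)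
    (ν : VectorMeasure (Space d) (Space d)) : Prop :=
  ν.variation univ < ⊤ ∧ ν.variation Ωᶜ = 0 ∧
    ∀ φ : Space d → ℝ, ContDiff ℝ ∞ φ → HasCompactSupport φ → tsupport φ ⊆ Ω →
      ∫ x in Ω, ρ x • gradient φ x =
        - VectorMeasure.integral ν φ (ContinuousLinearMap.lsmul ℝ ℝ)

/-- `ρ ∈ BV(Ω)`: `ρ` is integrable on `Ω` and its distributional gradient is a finite
vector-valued measure on `Ω`. -/
def IsBV {d : ℕ} (Ω : Set (Space d)) (ρ : Space d → ℝ) : Prop :=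
  IntegrableOn ρ Ω ∧ ∃ ν, IsGradientMeasure Ω ρ ν

/-- `ρ ∈ BV(Ω; {0,1})`. -/
def IsBVZeroOne {d : ℕ} (Ω : Set (Space d)) (ρ : Space d → ℝ) : Prop :=
  IsBV Ω ρ ∧ ∀ᵐ x ∂volume.restrict Ω, ρ x = 0 ∨ ρ x = 1

open Classical in
/-- The gradient measure `Dρ` of `ρ ∈ BV(Ω)` (and `0` by convention if there is none). -/
noncomputable def gradientMeasure {d : ℕ} (Ω : Set (Space d)) (ρ : Space d → ℝ) :
    VectorMeasure (Space d) (Space d) :=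
  if h : ∃ ν, IsGradientMeasure Ω ρ ν then h.choose else 0

theorem IsBV.isGradientMeasure {d : ℕ} {Ω : Set (Space d)} {ρ : Space d → ℝ} (h : IsBV Ω ρ) :
    IsGradientMeasure Ω ρ (gradientMeasure Ω ρ) := by
  rw [gradientMeasure, dif_pos h.2]
  exact h.2.choose_spec

/-! ### The polar density and the anisotropic measure -/

/-- The `i`-th component of an `ℝ^d`-valued measure. -/
noncomputable def vectorMeasureComponent {d : ℕ} (ν : VectorMeasure (Space d) (Space d))
    (i : Fin d) : SignedMeasure (Space d) :=
  ν.mapRange (EuclideanSpace.proj (𝕜 := ℝ) i : Space d →L[ℝ] ℝ).toLinearMap.toAddMonoidHom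
    (EuclideanSpace.proj (𝕜 := ℝ) i : Space d →L[ℝ] ℝ).continuous

theorem vectorMeasureComponent_apply {d : ℕ} (ν : VectorMeasure (Space d) (Space d))
    (i : Fin d) (s : Set (Space d)) : vectorMeasureComponent ν i s = ν s i := rfl

/-- The density `ν/|ν|` of a vector measure with respect to its total variation, by
Radon-Nikodym differentiation of each component. -/
noncomputable def polarDensity {d : ℕ} (ν : VectorMeasure (Space d) (Space d))
    (x : Space d) : Space d :=
  WithLp.toLp 2 fun i => (vectorMeasureComponent ν i).rnDeriv ν.variation x

theorem measurable_polarDensity {d : ℕ} (ν : VectorMeasure (Space d) (Space d)) :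
    Measurable (polarDensity ν) := by
  unfold polarDensity
  refine (WithLp.measurable_toLp 2 _).comp ?_
  exact measurable_pi_lambda _ fun i => SignedMeasure.measurable_rnDeriv _ _

theorem integrable_polarDensity {d : ℕ} (ν : VectorMeasure (Space d) (Space d)) :
    Integrable (polarDensity ν) ν.variation := by
  refine Integrable.of_eval_piLp fun i => ?_
  exact SignedMeasure.integrable_rnDeriv _ _

/-- `ν/|ν|` is the density of `ν` with respect to `|ν|`. -/
theorem withDensity_polarDensity {d : ℕ} (ν : VectorMeasure (Space d) (Space d))
    (hν : ν.variation univ < ⊤) : ν.variation.withDensityᵥ (polarDensity ν) = ν := by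
  have : IsFiniteMeasure ν.variation := ⟨hν⟩
  ext s hs i
  rw [withDensityᵥ_apply (integrable_polarDensity ν) hs]
  have h1 : (∫ x in s, polarDensity ν x ∂ν.variation) i =
      ∫ x in s, (vectorMeasureComponent ν i).rnDeriv ν.variation x ∂ν.variation :=
    ((EuclideanSpace.proj (𝕜 := ℝ) i : Space d →L[ℝ] ℝ).integral_comp_comm
      (integrable_polarDensity ν).integrableOn).symm
  have hac : vectorMeasureComponent ν i ≪ᵥ ν.variation.toENNRealVectorMeasure := by
    refine VectorMeasure.AbsolutelyContinuous.mk fun t ht h0 => ?_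
    rw [Measure.toENNRealVectorMeasure_apply_measurable ht] at h0
    have h2 := ν.enorm_measure_le_variation t
    rw [h0, nonpos_iff_eq_zero, enorm_eq_zero] at h2
    rw [vectorMeasureComponent_apply, h2]
    rfl
  have h3 := (SignedMeasure.absolutelyContinuous_iff_withDensityᵥ_rnDeriv_eq _ _).1 hac
  rw [h1, ← withDensityᵥ_apply (SignedMeasure.integrable_rnDeriv _ _) hs, h3]
  exact vectorMeasureComponent_apply ν i s

/-- The anisotropic measure `σ_J(ν)` of a nonnegative kernel `J`, i.e. the measure with density
`x ↦ ∫ J(z) |z · (ν/|ν|)(x)| dz` with respect to `|ν|`. -/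
noncomputable def sigmaMeasure {d : ℕ} (J : Space d → ℝ)
    (ν : VectorMeasure (Space d) (Space d)) : Measure (Space d) :=
  ν.variation.withDensity fun x =>
    ∫⁻ z, ENNReal.ofReal (J z * |inner ℝ z (polarDensity ν x)|)

/-- `σ_J(ν)` acts on bounded test functions as
`∫ ψ dσ_J(ν) = ∫ J(z) ∫ ψ(x) |z · (ν/|ν|)(x)| d|ν|(x) dz`. -/
theorem integral_sigmaMeasure {d : ℕ} {J : Space d → ℝ} (hJm : Measurable J)
    (hJ0 : ∀ z, 0 ≤ J z) (hJ : Integrable fun z => J z * ‖z‖)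
    (ν : VectorMeasure (Space d) (Space d)) (hν : ν.variation univ < ⊤)
    {ψ : Space d → ℝ} (hψm : AEStronglyMeasurable ψ ν.variation) {C : ℝ}
    (hψ : ∀ᵐ x ∂ν.variation, |ψ x| ≤ C) :
    ∫ x, ψ x ∂(sigmaMeasure J ν) =
      ∫ z, J z * ∫ x, ψ x * |inner ℝ z (polarDensity ν x)| ∂ν.variation := by
  have : IsFiniteMeasure ν.variation := ⟨hν⟩
  have hpm := measurable_polarDensity ν
  have hF : Measurable fun p : Space d × Space d =>
      J p.2 * |inner ℝ p.2 (polarDensity ν p.1)| := by fun_prop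
  have hFx : ∀ x, Integrable fun z => J z * |inner ℝ z (polarDensity ν x)| := by
    intro x
    refine (hJ.mul_const ‖polarDensity ν x‖).mono' (by fun_prop) (ae_of_all _ fun z => ?_)
    rw [Real.norm_of_nonneg (mul_nonneg (hJ0 z) (abs_nonneg _)), mul_assoc]
    exact mul_le_mul_of_nonneg_left (abs_real_inner_le_norm _ _) (hJ0 z)
  have hdens : ∀ x, ∫⁻ z, ENNReal.ofReal (J z * |inner ℝ z (polarDensity ν x)|) =
      ENNReal.ofReal (∫ z, J z * |inner ℝ z (polarDensity ν x)|) := fun x =>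
    (ofReal_integral_eq_lintegral_ofReal (hFx x)
      (ae_of_all _ fun z => mul_nonneg (hJ0 z) (abs_nonneg _))).symm
  unfold sigmaMeasure
  rw [integral_withDensity_eq_integral_toReal_smul
    (by exact Measurable.lintegral_prod_right' (f := fun p : Space d × Space d =>
      ENNReal.ofReal (J p.2 * |inner ℝ p.2 (polarDensity ν p.1)|)) hF.ennreal_ofReal)
    (ae_of_all _ fun x => by rw [hdens]; exact ENNReal.ofReal_lt_top)]
  have hprod : Integrable (fun p : Space d × Space d =>
      ψ p.1 * (J p.2 * |inner ℝ p.2 (polarDensity ν p.1)|)) (ν.variation.prod volume) := by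
    refine (((integrable_polarDensity ν).norm.mul_prod hJ).const_mul C).mono'
      (hψm.comp_fst.mul hF.aestronglyMeasurable) ?_
    have h1 : ∀ᵐ p ∂(ν.variation.prod (volume : Measure (Space d))), |ψ p.1| ≤ C :=
      Measure.quasiMeasurePreserving_fst.ae hψ
    filter_upwards [h1] with p hp
    rw [norm_mul, Real.norm_of_nonneg (mul_nonneg (hJ0 _) (abs_nonneg _)), Real.norm_eq_abs]
    refine mul_le_mul hp ?_ (mul_nonneg (hJ0 _) (abs_nonneg _)) ((abs_nonneg _).trans hp)
    calc J p.2 * |inner ℝ p.2 (polarDensity ν p.1)|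
        ≤ J p.2 * (‖p.2‖ * ‖polarDensity ν p.1‖) :=
          mul_le_mul_of_nonneg_left (abs_real_inner_le_norm _ _) (hJ0 _)
      _ = _ := by ring
  calc ∫ x, (∫⁻ z, ENNReal.ofReal (J z * |inner ℝ z (polarDensity ν x)|)).toReal • ψ x
        ∂ν.variation
      = ∫ x, (∫ z, ψ x * (J z * |inner ℝ z (polarDensity ν x)|)) ∂ν.variation := by
        congr 1
        ext x
        rw [hdens, ENNReal.toReal_ofReal
          (integral_nonneg fun z => mul_nonneg (hJ0 z) (abs_nonneg _)),
          integral_const_mul, smul_eq_mul, mul_comm]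
    _ = ∫ z, ∫ x, ψ x * (J z * |inner ℝ z (polarDensity ν x)|) ∂ν.variation :=
        integral_integral_swap hprod
    _ = _ := by
        congr 1
        ext z
        rw [← integral_const_mul]
        congr 1
        ext x
        ring

/-! ### Kernels -/

/-- The heat kernel `G = G_1` on `ℝ^d` at time one. -/
noncomputable def heatKernelOne {d : ℕ} (z : Space d) : ℝ :=
  ((4 * Real.pi) ^ ((d : ℝ) / 2))⁻¹ * Real.exp (-(‖z‖ ^ 2) / 4)

/-- `J` has rapid decay: `J(z) ≤ |P(z)| G(z)` for some polynomial `P`. -/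
def HasRapidDecay {d : ℕ} (J : Space d → ℝ) : Prop :=
  ∃ P : MvPolynomial (Fin d) ℝ, ∀ z : Space d,
    J z ≤ |MvPolynomial.eval (fun i => z i) P| * heatKernelOne z

/-- The rescaled kernel `J_ε(z) = ε^{-(d+1)} J(z/ε)`. -/
noncomputable def rescaledKernel {d : ℕ} (J : Space d → ℝ) (ε : ℝ) (z : Space d) : ℝ :=
  (ε ^ (d + 1))⁻¹ * J (ε⁻¹ • z)

/-- `(J_ε ⋆ ρ)(x)`, where `ρ` is extended by zero outside `Ω`. -/
noncomputable def kernelConvolution {d : ℕ} (Ω : Set (Space d)) (J : Space d → ℝ) (ε : ℝ)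
    (ρ : Space d → ℝ) (x : Space d) : ℝ :=
  convolution (rescaledKernel J ε) (Ω.indicator ρ) (ContinuousLinearMap.lsmul ℝ ℝ) volume x

/-! ### Vector measures and their polar densities -/

theorem norm_polarDensity_eq_one {d : ℕ} (ν : VectorMeasure (Space d) (Space d))
    (hν : ν.variation univ < ⊤) : ∀ᵐ x ∂ν.variation, ‖polarDensity ν x‖ = 1 := by
  have : IsFiniteMeasure ν.variation := ⟨hν⟩
  have h1 := Measure.variation_withDensityᵥ (integrable_polarDensity ν)
  rw [withDensity_polarDensity ν hν] at h1
  have h2 : ν.variation.withDensity (fun x => ‖polarDensity ν x‖ₑ) =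
      ν.variation.withDensity 1 := by rw [← h1, withDensity_one]
  have hm := measurable_polarDensity ν
  rw [withDensity_eq_iff_of_sigmaFinite (by fun_prop) (by fun_prop)] at h2
  filter_upwards [h2] with x hx
  simpa [enorm_eq_iff_norm_eq] using congrArg ENNReal.toReal hx

theorem VectorMeasure.integral_lsmul_eq_integral_polarDensity {d : ℕ}
    (ν : VectorMeasure (Space d) (Space d)) (hν : ν.variation univ < ⊤) {f : Space d → ℝ}
    (hf : Integrable f ν.variation) :
    VectorMeasure.integral ν f (ContinuousLinearMap.lsmul ℝ ℝ) =
      ∫ x, f x • polarDensity ν x ∂ν.variation := by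
  have : IsFiniteMeasure ν.variation := ⟨hν⟩
  have hp1 := norm_polarDensity_eq_one ν hν
  have hpm := measurable_polarDensity ν
  have hsm : ∀ g : Space d → ℝ, Integrable g ν.variation →
      Integrable (fun x => g x • polarDensity ν x) ν.variation := by
    intro g hg
    refine hg.norm.mono' (hg.aestronglyMeasurable.smul hpm.aestronglyMeasurable) ?_
    filter_upwards [hp1] with x hx
    rw [norm_smul, hx, mul_one]
  refine Integrable.induction (P := fun f => VectorMeasure.integral ν f
    (ContinuousLinearMap.lsmul ℝ ℝ) = ∫ x, f x • polarDensity ν x ∂ν.variation) ?_ ?_ ?_ ?_ hf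
  · intro c s hs _
    rw [VectorMeasure.integral_indicator hs]
    have h0 : ∫ᵛ x in s, c ∂•ν = c • ν s := by
      have : IsFiniteMeasure (ν.restrict s).variation := by
        rw [VectorMeasure.variation_restrict hs]; infer_instance
      rw [VectorMeasure.integral_const]
      simp [VectorMeasure.restrict_apply, hs]
    rw [h0]
    have h1 : (fun x => s.indicator (fun _ => c) x • polarDensity ν x) =
        s.indicator (fun x => c • polarDensity ν x) := by
      ext1 x
      by_cases hx : x ∈ s <;> simp [hx]
    rw [h1, integral_indicator hs, integral_smul]
    conv_lhs => rw [← withDensity_polarDensity ν hν]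
    rw [withDensityᵥ_apply (integrable_polarDensity ν) hs]
  · intro f g _ hf hg ihf ihg
    rw [VectorMeasure.integral_add hf hg, ihf, ihg, ← integral_add (hsm f hf) (hsm g hg)]
    simp [add_smul]
  · refine isClosed_eq VectorMeasure.continuous_integral ?_
    refine (LipschitzWith.of_dist_le_mul (K := 1) fun f g => ?_).continuous
    rw [dist_eq_norm, ← integral_sub (hsm _ (L1.integrable_coeFn f)) (hsm _ (L1.integrable_coeFn g)),
      NNReal.coe_one, one_mul, L1.dist_eq_integral_dist]
    refine norm_integral_le_of_norm_le ?_ ?_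
    · simpa [dist_eq_norm] using ((L1.integrable_coeFn f).sub (L1.integrable_coeFn g)).norm
    · filter_upwards [hp1] with x hx
      rw [← sub_smul, norm_smul, hx, mul_one, dist_eq_norm]
  · intro f g hfg hf ih
    rw [← VectorMeasure.integral_congr_ae hfg, ih]
    refine integral_congr_ae ?_
    filter_upwards [hfg] with x hx
    rw [hx]

theorem continuous_gradient_and_exists_bound {d : ℕ} {φ : Space d → ℝ} (hφ : ContDiff ℝ ∞ φ)
    (hφc : HasCompactSupport φ) :
    Continuous (gradient φ) ∧ ∃ C, ∀ x, ‖gradient φ x‖ ≤ C := by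
  have hDc : Continuous (fderiv ℝ φ) := hφ.continuous_fderiv (by simp)
  obtain ⟨C, hC⟩ := (hφc.fderiv ℝ).exists_bound_of_continuous hDc
  refine ⟨(InnerProductSpace.toDual ℝ (Space d)).symm.continuous.comp hDc, C, fun x => ?_⟩
  rw [gradient, LinearIsometryEquiv.norm_map]
  exact hC x

theorem IsGradientMeasure.add {d : ℕ} {Ω : Set (Space d)} {ρ₁ ρ₂ : Space d → ℝ}
    {ν₁ ν₂ : VectorMeasure (Space d) (Space d)} (hρ₁ : IntegrableOn ρ₁ Ω)
    (hρ₂ : IntegrableOn ρ₂ Ω) (h₁ : IsGradientMeasure Ω ρ₁ ν₁)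
    (h₂ : IsGradientMeasure Ω ρ₂ ν₂) : IsGradientMeasure Ω (ρ₁ + ρ₂) (ν₁ + ν₂) := by
  obtain ⟨ha₁, hb₁, hc₁⟩ := h₁
  obtain ⟨ha₂, hb₂, hc₂⟩ := h₂
  have hle : (ν₁ + ν₂).variation ≤ ν₁.variation + ν₂.variation :=
    VectorMeasure.variation_add_le
  refine ⟨(hle univ).trans_lt ?_, le_antisymm ((hle Ωᶜ).trans ?_) zero_le, ?_⟩
  · simpa using ⟨ha₁, ha₂⟩
  · simp [hb₁, hb₂]
  · intro φ hφ hφc hφs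
    have : IsFiniteMeasure ν₁.variation := ⟨ha₁⟩
    have : IsFiniteMeasure ν₂.variation := ⟨ha₂⟩
    rw [VectorMeasure.integral_add_vectorMeasure (hφ.continuous.integrable_of_hasCompactSupport hφc)
      (hφ.continuous.integrable_of_hasCompactSupport hφc), neg_add, ← hc₁ φ hφ hφc hφs,
      ← hc₂ φ hφ hφc hφs]
    obtain ⟨hgc, C, hC⟩ := continuous_gradient_and_exists_bound hφ hφc
    have hi : ∀ ρ : Space d → ℝ, IntegrableOn ρ Ω → IntegrableOn (fun x => ρ x • gradient φ x) Ω :=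
      fun ρ hρ => hρ.smul_bdd C hgc.aestronglyMeasurable (ae_of_all _ hC)
    rw [← integral_add (hi _ hρ₁) (hi _ hρ₂)]
    simp [add_smul]

theorem IsGradientMeasure.congr {d : ℕ} {Ω : Set (Space d)} {ρ₁ ρ₂ : Space d → ℝ}
    {ν : VectorMeasure (Space d) (Space d)} (h : IsGradientMeasure Ω ρ₁ ν)
    (hρ : ρ₁ =ᵐ[volume.restrict Ω] ρ₂) : IsGradientMeasure Ω ρ₂ ν := by
  refine ⟨h.1, h.2.1, fun φ hφ hφc hφs => ?_⟩
  rw [← h.2.2 φ hφ hφc hφs]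
  refine integral_congr_ae ?_
  filter_upwards [hρ] with x hx
  rw [hx]

theorem IsBV.add {d : ℕ} {Ω : Set (Space d)} {ρ₁ ρ₂ : Space d → ℝ} (h₁ : IsBV Ω ρ₁)
    (h₂ : IsBV Ω ρ₂) : IsBV Ω (ρ₁ + ρ₂) :=
  ⟨h₁.1.add h₂.1, _, h₁.isGradientMeasure.add h₁.1 h₂.1 h₂.isGradientMeasure⟩

/-- The defining identity of the gradient measure, in a fixed direction. -/
theorem IsGradientMeasure.integral_mul_fderiv {d : ℕ} {Ω : Set (Space d)} {ρ : Space d → ℝ}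
    {ν : VectorMeasure (Space d) (Space d)} (h : IsGradientMeasure Ω ρ ν)
    (hρ : IntegrableOn ρ Ω) {φ : Space d → ℝ} (hφ : ContDiff ℝ ∞ φ) (hφc : HasCompactSupport φ)
    (hφs : tsupport φ ⊆ Ω) (v : Space d) :
    ∫ x in Ω, ρ x * fderiv ℝ φ x v =
      -∫ x, φ x * inner ℝ v (polarDensity ν x) ∂ν.variation := by
  have : IsFiniteMeasure ν.variation := ⟨h.1⟩
  obtain ⟨hgc, C, hC⟩ := continuous_gradient_and_exists_bound hφ hφc
  obtain ⟨C', hC'⟩ := hφc.exists_bound_of_continuous hφ.continuous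
  have h1 := h.2.2 φ hφ hφc hφs
  rw [VectorMeasure.integral_lsmul_eq_integral_polarDensity ν h.1
    (hφ.continuous.integrable_of_hasCompactSupport hφc)] at h1
  have hφp : Integrable (fun x => φ x • polarDensity ν x) ν.variation := by
    refine ((integrable_polarDensity ν).norm.const_mul C').mono'
      (hφ.continuous.aestronglyMeasurable.smul
        (measurable_polarDensity ν).aestronglyMeasurable) (ae_of_all _ fun x => ?_)
    rw [norm_smul]
    exact mul_le_mul_of_nonneg_right (hC' x) (norm_nonneg _)
  have h2 := integral_inner (𝕜 := ℝ) (μ := volume.restrict Ω) (f := fun x => ρ x • gradient φ x)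
    (hρ.smul_bdd C hgc.aestronglyMeasurable (ae_of_all _ hC)) v
  have h3 := integral_inner (𝕜 := ℝ) (μ := ν.variation) (f := fun x => φ x • polarDensity ν x)
    hφp v
  simp only [inner_smul_right] at h2 h3
  rw [h3, ← inner_neg_right (𝕜 := ℝ), ← h1, ← h2]
  refine integral_congr_ae (ae_of_all _ fun x => ?_)
  simp only [inner_gradient_right]
  simp

/-! ### Approximation of the sign of a function by test functions -/

theorem exists_contDiff_one_on_compact {d : ℕ} {K U : Set (Space d)} (hK : IsCompact K)
    (hU : IsOpen U) (hKU : K ⊆ U) :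
    ∃ f : Space d → ℝ, ContDiff ℝ ∞ f ∧ HasCompactSupport f ∧ tsupport f ⊆ U ∧
      (∀ x ∈ K, f x = 1) ∧ ∀ x, f x ∈ Icc (0 : ℝ) 1 := by
  obtain ⟨L, hL, hKL, hLU⟩ := exists_compact_between hK hU hKU
  obtain ⟨f, hf1, hf0, hf⟩ := exists_contMDiffMap_one_nhds_of_subset_interior
    (modelWithCornersSelf ℝ (Space d)) (n := ⊤) hK.isClosed hKL
  have hts : tsupport f ⊆ L := by
    refine closure_minimal (fun x hx => ?_) hL.isClosed
    by_contra h
    exact hx (hf0 x h)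
  exact ⟨f, f.contMDiff.contDiff, hL.of_isClosed_subset (isClosed_tsupport _) hts,
    hts.trans hLU, fun x hx => hf1.self_of_nhdsSet x hx, hf⟩

theorem exists_contDiff_setIntegral_abs_sub_le {d : ℕ} (m : Measure (Space d)) {U : Set (Space d)}
    (hU : IsOpen U) {g : Space d → ℝ} (hgm : Measurable g) (hg : IntegrableOn g U m) {η : ℝ}
    (hη : 0 < η) :
    ∃ φ : Space d → ℝ, ContDiff ℝ ∞ φ ∧ HasCompactSupport φ ∧ tsupport φ ⊆ U ∧
      (∀ x, |φ x| ≤ 1) ∧ ∫ x in U, |g x| ∂m - η ≤ ∫ x in U, φ x * g x ∂m := by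
  set μ : Measure (Space d) := (m.restrict U).withDensity fun x => ‖g x‖ₑ with hμ
  have hfin : IsFiniteMeasure μ := ⟨by
    rw [hμ, withDensity_apply _ MeasurableSet.univ, Measure.restrict_univ]; exact hg.2⟩
  have key : ∀ A : Set (Space d), MeasurableSet A → ∃ K ⊆ A, IsCompact K ∧
      ∫ x in A \ K, |g x| ∂(m.restrict U) ≤ η / 4 := by
    intro A hA
    obtain ⟨K, hKA, hK, hlt⟩ := hA.exists_isCompact_sdiff_lt (μ := μ) (measure_ne_top _ _)
      (ε := ENNReal.ofReal (η / 4)) (by simpa using hη)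
    refine ⟨K, hKA, hK, ?_⟩
    rw [hμ, withDensity_apply _ (hA.diff hK.measurableSet)] at hlt
    rw [integral_eq_lintegral_of_nonneg_ae (ae_of_all _ fun x => abs_nonneg _)
      (by fun_prop)]
    refine ENNReal.toReal_le_of_le_ofReal (by positivity) (le_of_eq_of_le ?_ hlt.le)
    refine lintegral_congr fun x => ?_
    rw [← Real.norm_eq_abs, ofReal_norm]
  have hmA : MeasurableSet (U ∩ {x | 0 ≤ g x}) :=
    hU.measurableSet.inter (measurableSet_le measurable_const hgm)
  have hmB : MeasurableSet (U ∩ {x | g x < 0}) :=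
    hU.measurableSet.inter (measurableSet_lt hgm measurable_const)
  obtain ⟨K, hKA, hK, hKη⟩ := key _ hmA
  obtain ⟨L, hLB, hL, hLη⟩ := key _ hmB
  have hKL : ∀ x ∈ K, x ∉ L := fun x hx hx' => by
    have h1 := (hKA hx).2
    have h2 := (hLB hx').2
    simp only [mem_ofPred_eq] at h1 h2
    linarith
  obtain ⟨f₁, hf₁, hf₁c, hf₁s, hf₁1, hf₁b⟩ := exists_contDiff_one_on_compact hK
    (hU.inter hL.isClosed.isOpen_compl) (fun x hx => ⟨(hKA hx).1, hKL x hx⟩)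
  obtain ⟨f₂, hf₂, hf₂c, hf₂s, hf₂1, hf₂b⟩ := exists_contDiff_one_on_compact hL
    (hU.inter hK.isClosed.isOpen_compl) (fun x hx => ⟨(hLB hx).1, fun h => hKL x h hx⟩)
  have hf₁0 : ∀ x ∈ L, f₁ x = 0 := fun x hx => by
    by_contra h
    exact (hf₁s (subset_tsupport _ h)).2 hx
  have hf₂0 : ∀ x ∈ K, f₂ x = 0 := fun x hx => by
    by_contra h
    exact (hf₂s (subset_tsupport _ h)).2 hx
  have hb : ∀ x, |f₁ x - f₂ x| ≤ 1 := fun x => by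
    have h1 := hf₁b x
    have h2 := hf₂b x
    rw [abs_le]
    constructor <;> linarith [h1.1, h1.2, h2.1, h2.2]
  refine ⟨fun x => f₁ x - f₂ x, hf₁.sub hf₂, hf₁c.sub hf₂c,
    (tsupport_sub f₁ f₂).trans (union_subset (hf₁s.trans inter_subset_left)
      (hf₂s.trans inter_subset_left)), hb, ?_⟩
  have hgi : Integrable (fun x => |g x|) (m.restrict U) := hg.abs
  have hφg : Integrable (fun x => (f₁ x - f₂ x) * g x) (m.restrict U) :=
    Integrable.bdd_mul hg (hf₁.sub hf₂).continuous.aestronglyMeasurable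
      (c := 1) (ae_of_all _ hb)
  have hle : ∫ x in U, (|g x| - (f₁ x - f₂ x) * g x) ∂m ≤
      ∫ x in U, (2 * (((U ∩ {x | 0 ≤ g x}) \ K).indicator (fun x => |g x|) x) +
        2 * (((U ∩ {x | g x < 0}) \ L).indicator (fun x => |g x|) x)) ∂m := by
    refine setIntegral_mono_on (hgi.sub hφg) (((hgi.indicator
      (hmA.diff hK.measurableSet)).const_mul 2).add ((hgi.indicator
      (hmB.diff hL.measurableSet)).const_mul 2)) hU.measurableSet fun x hx => ?_
    have h3 : |g x| - (f₁ x - f₂ x) * g x ≤ 2 * |g x| := by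
      have : |(f₁ x - f₂ x) * g x| ≤ 1 * |g x| := by
        rw [abs_mul]
        exact mul_le_mul_of_nonneg_right (hb x) (abs_nonneg _)
      linarith [neg_abs_le ((f₁ x - f₂ x) * g x)]
    by_cases h0 : 0 ≤ g x
    · have hnb : x ∉ (U ∩ {x | g x < 0}) \ L := fun h => by
        have := h.1.2
        simp only [mem_ofPred_eq] at this
        linarith
      rw [indicator_of_notMem hnb]
      by_cases hxK : x ∈ K
      · rw [indicator_of_notMem (fun h => h.2 hxK), hf₁1 x hxK, hf₂0 x hxK, abs_of_nonneg h0]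
        linarith
      · have hm : x ∈ (U ∩ {x | 0 ≤ g x}) \ K := ⟨⟨hx, h0⟩, hxK⟩
        rw [indicator_of_mem hm]
        linarith
    · have hna : x ∉ (U ∩ {x | 0 ≤ g x}) \ K := fun h => h0 h.1.2
      rw [indicator_of_notMem hna]
      push Not at h0
      by_cases hxL : x ∈ L
      · rw [indicator_of_notMem (fun h => h.2 hxL), hf₁0 x hxL, hf₂1 x hxL, abs_of_neg h0]
        linarith
      · have hm : x ∈ (U ∩ {x | g x < 0}) \ L := ⟨⟨hx, h0⟩, hxL⟩
        rw [indicator_of_mem hm]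
        linarith
  rw [integral_sub hgi hφg, integral_add ((hgi.indicator
      (hmA.diff hK.measurableSet)).const_mul 2) ((hgi.indicator
      (hmB.diff hL.measurableSet)).const_mul 2), integral_const_mul, integral_const_mul,
    integral_indicator (hmA.diff hK.measurableSet),
    integral_indicator (hmB.diff hL.measurableSet)] at hle
  linarith

/-! ### Difference quotients of functions of bounded variation -/

/-- The points `x` of `Ω` such that `x - h` is in `Ω` too. -/
def translateInter {d : ℕ} (Ω : Set (Space d)) (h : Space d) : Set (Space d) :=
  {x | x ∈ Ω ∧ x - h ∈ Ω}

theorem IsOpen.translateInter {d : ℕ} {Ω : Set (Space d)} (hΩ : IsOpen Ω) (h : Space d) :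
    IsOpen (translateInter Ω h) :=
  hΩ.inter (hΩ.preimage (continuous_id.sub continuous_const))

theorem integrable_inner_polarDensity {d : ℕ} (ν : VectorMeasure (Space d) (Space d))
    (z : Space d) : Integrable (fun x => inner ℝ z (polarDensity ν x)) ν.variation :=
  (integrable_polarDensity ν).const_inner z

theorem tsupport_comp_add_right {d : ℕ} (φ : Space d → ℝ) (a : Space d) :
    tsupport (fun x => φ (x + a)) = (fun x => x + a) ⁻¹' tsupport φ :=
  tsupport_comp_eq_preimage φ (Homeomorph.addRight a)

theorem Convex.tsupport_comp_add_subset {d : ℕ} {Ω : Set (Space d)} (hΩc : Convex ℝ Ω)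
    {φ : Space d → ℝ} {h : Space d} (hφs : tsupport φ ⊆ translateInter Ω h) {t : ℝ}
    (ht : t ∈ Icc (0 : ℝ) 1) : tsupport (fun x => φ (x + t • h)) ⊆ Ω := by
  rw [tsupport_comp_add_right]
  intro x hx
  obtain ⟨h1, h2⟩ := hφs hx
  have h3 := hΩc h1 h2 (sub_nonneg.2 ht.2) ht.1 (by ring)
  convert h3 using 1
  module

/-- For a test function `φ` supported in `Ω ∩ (Ω + h)`, the increments of `u` in direction `h`
are averages of the gradient measure. -/
theorem IsGradientMeasure.integral_mul_increment {d : ℕ} {Ω : Set (Space d)}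
    (hΩc : Convex ℝ Ω) {u : Space d → ℝ} (hu : Integrable u) (hu0 : ∀ x ∉ Ω, u x = 0)
    {ν : VectorMeasure (Space d) (Space d)} (hν : IsGradientMeasure Ω u ν)
    {φ : Space d → ℝ} (hφ : ContDiff ℝ ∞ φ) (hφc : HasCompactSupport φ) {h : Space d}
    (hφs : tsupport φ ⊆ translateInter Ω h) :
    ∫ x, φ x * (u x - u (x - h)) =
      ∫ t in (0 : ℝ)..1, ∫ x, φ (x + t • h) * inner ℝ h (polarDensity ν x) ∂ν.variation := by
  have hI : ∀ t ∈ Icc (0 : ℝ) 1, ∫ x, φ (x + t • h) * inner ℝ h (polarDensity ν x) ∂ν.variation =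
      -∫ x, u x * fderiv ℝ φ (x + t • h) h := by
    intro t ht
    have h1 := hν.integral_mul_fderiv hu.integrableOn (φ := fun x => φ (x + t • h))
      (hφ.comp (contDiff_id.add contDiff_const))
      (hφc.comp_homeomorph (Homeomorph.addRight (t • h)))
      (hΩc.tsupport_comp_add_subset hφs ht) h
    rw [setIntegral_eq_integral_of_forall_compl_eq_zero
      (fun x hx => by rw [hu0 x hx, zero_mul])] at h1
    simp only [fderiv_comp_add_right] at h1
    rw [h1, neg_neg]
  have hDc : Continuous (fderiv ℝ φ) := hφ.continuous_fderiv (by simp)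
  obtain ⟨C, hC⟩ := (hφc.fderiv ℝ).exists_bound_of_continuous hDc
  obtain ⟨C', hC'⟩ := hφc.exists_bound_of_continuous hφ.continuous
  have hFTC : ∀ x, ∫ t in (0 : ℝ)..1, fderiv ℝ φ (x + t • h) h = φ (x + h) - φ x := by
    intro x
    have hd : ∀ t ∈ uIcc (0 : ℝ) 1, HasDerivAt (fun t : ℝ => φ (x + t • h))
        (fderiv ℝ φ (x + t • h) h) t := by
      intro t _
      have h1 := (hφ.differentiable (by simp) (x + t • h)).hasFDerivAt
      have h2 : HasDerivAt (fun t : ℝ => x + t • h) h t := by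
        simpa using ((hasDerivAt_id t).smul_const h).const_add x
      exact h1.comp_hasDerivAt t h2
    rw [intervalIntegral.integral_eq_sub_of_hasDerivAt hd
      (Continuous.intervalIntegrable (by fun_prop) _ _)]
    simp
  have hprod : Integrable (Function.uncurry fun (t : ℝ) (x : Space d) =>
      u x * fderiv ℝ φ (x + t • h) h) ((volume.restrict (uIoc (0 : ℝ) 1)).prod volume) := by
    have hfin : IsFiniteMeasure (volume.restrict (uIoc (0 : ℝ) 1)) := by
      rw [uIoc_of_le zero_le_one]; infer_instance
    have h1 : Integrable (fun p : ℝ × Space d => u p.2)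
        ((volume.restrict (uIoc (0 : ℝ) 1)).prod volume) := hu.comp_snd _
    refine h1.mul_bdd (c := C * ‖h‖) ?_ (ae_of_all _ fun p => ?_)
    · exact Continuous.aestronglyMeasurable (by fun_prop)
    · exact (ContinuousLinearMap.le_opNorm _ _).trans
        (mul_le_mul_of_nonneg_right (hC _) (norm_nonneg _))
  have hr : ∫ t in (0 : ℝ)..1, ∫ x, φ (x + t • h) * inner ℝ h (polarDensity ν x) ∂ν.variation =
      ∫ t in (0 : ℝ)..1, -∫ x, u x * fderiv ℝ φ (x + t • h) h := by
    refine intervalIntegral.integral_congr fun t ht => hI t ?_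
    rwa [uIcc_of_le zero_le_one] at ht
  rw [hr, intervalIntegral.integral_neg, intervalIntegral_integral_swap hprod]
  simp only [intervalIntegral.integral_const_mul, hFTC]
  have i1 : Integrable fun x => φ x * u x :=
    hu.bdd_mul (c := C') hφ.continuous.aestronglyMeasurable (ae_of_all _ hC')
  have i2 : Integrable fun x => φ x * u (x - h) :=
    (hu.comp_sub_right h).bdd_mul (c := C') hφ.continuous.aestronglyMeasurable (ae_of_all _ hC')
  have i3 : Integrable fun x => φ (x + h) * u x := by
    simpa using i2.comp_add_right h
  have e1 : ∫ x, φ (x + h) * u x = ∫ x, φ x * u (x - h) := by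
    rw [← integral_add_right_eq_self (fun x => φ x * u (x - h)) h]
    simp
  simp only [mul_sub]
  rw [integral_sub i1 i2, integral_sub (by simpa [mul_comm] using i3) (by simpa [mul_comm] using i1),
    ← e1]
  simp only [mul_comm (u _)]
  ring

theorem IsGradientMeasure.abs_integral_mul_increment_le {d : ℕ} {Ω : Set (Space d)}
    (hΩc : Convex ℝ Ω) {u : Space d → ℝ} (hu : Integrable u) (hu0 : ∀ x ∉ Ω, u x = 0)
    {ν : VectorMeasure (Space d) (Space d)} (hν : IsGradientMeasure Ω u ν)
    {φ : Space d → ℝ} (hφ : ContDiff ℝ ∞ φ) (hφc : HasCompactSupport φ) {h : Space d}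
    (hφs : tsupport φ ⊆ translateInter Ω h) (hφ1 : ∀ x, |φ x| ≤ 1) :
    |∫ x, φ x * (u x - u (x - h))| ≤ ∫ x, |inner ℝ h (polarDensity ν x)| ∂ν.variation := by
  rw [hν.integral_mul_increment hΩc hu hu0 hφ hφc hφs, ← Real.norm_eq_abs]
  refine (intervalIntegral.norm_integral_le_of_norm_le_const fun t _ => ?_).trans
    (by simp : (∫ x, |inner ℝ h (polarDensity ν x)| ∂ν.variation) * |(1 : ℝ) - 0| ≤ _)
  refine norm_integral_le_of_norm_le (integrable_inner_polarDensity ν h).abs (ae_of_all _ fun x => ?_)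
  rw [norm_mul, Real.norm_eq_abs, Real.norm_eq_abs]
  exact mul_le_of_le_one_left (abs_nonneg _) (hφ1 _)

/-- The total variation of the increments of `u` in direction `h` is controlled by that of
`h · Du`. -/
theorem IsGradientMeasure.setIntegral_abs_increment_le {d : ℕ} {Ω : Set (Space d)}
    (hΩo : IsOpen Ω) (hΩc : Convex ℝ Ω) {u : Space d → ℝ} (hum : Measurable u)
    (hu : Integrable u) (hu0 : ∀ x ∉ Ω, u x = 0)
    {ν : VectorMeasure (Space d) (Space d)} (hν : IsGradientMeasure Ω u ν) (h : Space d) :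
    ∫ x in translateInter Ω h, |u x - u (x - h)| ≤
      ∫ x, |inner ℝ h (polarDensity ν x)| ∂ν.variation := by
  refine le_of_forall_pos_le_add fun η hη => ?_
  have hi : Integrable fun x => u x - u (x - h) := hu.sub (hu.comp_sub_right h)
  obtain ⟨φ, hφ, hφc, hφs, hφ1, hφη⟩ := exists_contDiff_setIntegral_abs_sub_le volume
    (hΩo.translateInter h) (g := fun x => u x - u (x - h)) (by fun_prop) hi.integrableOn hη
  have h1 := hν.abs_integral_mul_increment_le hΩc hu hu0 hφ hφc hφs hφ1
  have h2 : ∫ x in translateInter Ω h, φ x * (u x - u (x - h)) =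
      ∫ x, φ x * (u x - u (x - h)) :=
    setIntegral_eq_integral_of_forall_compl_eq_zero fun x hx => by
      rw [image_eq_zero_of_notMem_tsupport (fun h => hx (hφs h)), zero_mul]
  linarith [le_abs_self (∫ x, φ x * (u x - u (x - h)))]

theorem eventually_subset_translateInter {d : ℕ} {Ω : Set (Space d)} (hΩo : IsOpen Ω)
    {K : Set (Space d)} (hK : IsCompact K) (hKΩ : K ⊆ Ω) (z : Space d) :
    ∀ᶠ ε in 𝓝[>] (0 : ℝ), K ⊆ translateInter Ω (ε • z) := by
  obtain ⟨δ, hδ, hδΩ⟩ := hK.exists_thickening_subset_open hΩo hKΩ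
  have h1 : Tendsto (fun ε : ℝ => ‖ε • z‖) (𝓝[>] 0) (𝓝 0) := by
    have : Continuous fun ε : ℝ => ‖ε • z‖ := by fun_prop
    simpa using this.continuousWithinAt (s := Ioi 0) (x := 0) |>.tendsto
  filter_upwards [h1.eventually_lt_const hδ] with ε hε x hx
  refine ⟨hKΩ hx, hδΩ (Metric.mem_thickening_iff.2 ⟨x, hx, ?_⟩)⟩
  simpa [dist_eq_norm] using hε

/-- The difference quotients of `u` in direction `z` converge to `z · Du` in the sense of
distributions. -/
theorem IsGradientMeasure.tendsto_integral_mul_increment {d : ℕ} {Ω : Set (Space d)}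
    (hΩo : IsOpen Ω) (hΩc : Convex ℝ Ω) {u : Space d → ℝ}
    (hu : Integrable u) (hu0 : ∀ x ∉ Ω, u x = 0)
    {ν : VectorMeasure (Space d) (Space d)} (hν : IsGradientMeasure Ω u ν)
    {φ : Space d → ℝ} (hφ : ContDiff ℝ ∞ φ) (hφc : HasCompactSupport φ) (hφs : tsupport φ ⊆ Ω)
    (z : Space d) :
    Tendsto (fun ε : ℝ => ε⁻¹ * ∫ x, φ x * (u x - u (x - ε • z))) (𝓝[>] 0)
      (𝓝 (∫ x, φ x * inner ℝ z (polarDensity ν x) ∂ν.variation)) := by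
  obtain ⟨L, hL⟩ := hφ.lipschitzWith_of_hasCompactSupport hφc (by simp)
  obtain ⟨C, hC⟩ := hφc.exists_bound_of_continuous hφ.continuous
  set T := ∫ x, |inner ℝ z (polarDensity ν x)| ∂ν.variation with hT
  have hw := integrable_inner_polarDensity ν z
  have hlim : Tendsto (fun ε : ℝ => L * (ε * ‖z‖) * T) (𝓝[>] 0) (𝓝 0) := by
    have : Continuous fun ε : ℝ => L * (ε * ‖z‖) * T := by fun_prop
    simpa using this.continuousWithinAt (s := Ioi 0) (x := 0) |>.tendsto
  rw [tendsto_iff_norm_sub_tendsto_zero]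
  refine squeeze_zero' (Eventually.of_forall fun _ => norm_nonneg _) ?_ hlim
  filter_upwards [eventually_subset_translateInter hΩo hφc hφs z, self_mem_nhdsWithin]
    with ε hε (hε0 : 0 < ε)
  rw [hν.integral_mul_increment hΩc hu hu0 hφ hφc hε]
  have hφm := hφ.continuous
  have hint : ∀ t : ℝ, Integrable (fun x => φ (x + t • ε • z) * inner ℝ z (polarDensity ν x))
      ν.variation := fun t => hw.bdd_mul (c := C)
    (Continuous.aestronglyMeasurable (by fun_prop)) (ae_of_all _ fun x => hC _)
  have h1 : ∀ t : ℝ, ∫ x, φ (x + t • ε • z) * inner ℝ (ε • z) (polarDensity ν x) ∂ν.variation =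
      ε * ∫ x, φ (x + t • ε • z) * inner ℝ z (polarDensity ν x) ∂ν.variation := by
    intro t
    rw [← integral_const_mul]
    congr 1
    ext x
    rw [real_inner_smul_left]
    ring
  simp only [h1]
  rw [intervalIntegral.integral_const_mul, inv_mul_cancel_left₀ hε0.ne']
  have hcont : Continuous fun t : ℝ =>
      ∫ x, φ (x + t • ε • z) * inner ℝ z (polarDensity ν x) ∂ν.variation := by
    refine continuous_of_dominated (bound := fun x => C * |inner ℝ z (polarDensity ν x)|)
      (fun t => (hint t).aestronglyMeasurable) (fun t => ae_of_all _ fun x => ?_)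
      (hw.abs.const_mul C) (ae_of_all _ fun x => ?_)
    · rw [norm_mul, Real.norm_eq_abs (inner ℝ z (polarDensity ν x))]
      exact mul_le_mul_of_nonneg_right (hC _) (abs_nonneg _)
    · exact (hφ.continuous.comp (by fun_prop)).mul continuous_const
  have h2 : ∫ x, φ x * inner ℝ z (polarDensity ν x) ∂ν.variation =
      ∫ t in (0 : ℝ)..1, ∫ x, φ x * inner ℝ z (polarDensity ν x) ∂ν.variation := by simp
  rw [h2, ← intervalIntegral.integral_sub (hcont.intervalIntegrable _ _)
    (by simp)]
  refine (intervalIntegral.norm_integral_le_of_norm_le_const fun t ht => ?_).trans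
    (by simp : (L * (ε * ‖z‖) * T) * |(1 : ℝ) - 0| ≤ _)
  have hint0 : Integrable (fun x => φ x * inner ℝ z (polarDensity ν x)) ν.variation := by
    simpa using hint 0
  rw [← integral_sub (hint t) hint0, hT, ← integral_const_mul]
  refine norm_integral_le_of_norm_le (hw.abs.const_mul _) (ae_of_all _ fun x => ?_)
  rw [← sub_mul, norm_mul, Real.norm_eq_abs (inner ℝ z (polarDensity ν x))]
  refine mul_le_mul_of_nonneg_right ?_ (abs_nonneg _)
  rw [uIoc_of_le zero_le_one] at ht
  rw [← dist_eq_norm]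
  refine (hL.dist_le_mul _ _).trans (mul_le_mul_of_nonneg_left ?_ L.2)
  rw [dist_eq_norm, add_sub_cancel_left, norm_smul, norm_smul, Real.norm_of_nonneg ht.1.le,
    Real.norm_of_nonneg hε0.le]
  exact mul_le_of_le_one_left (by positivity) ht.2

theorem abs_integral_mul_abs_sub_le {α : Type*} [MeasurableSpace α] {μ : Measure α}
    {g φ ζ : α → ℝ} (hg : Integrable g μ) (hφ : AEStronglyMeasurable φ μ)
    (hφ1 : ∀ x, |φ x| ≤ 1) {C : ℝ} (hζ : ∀ᵐ x ∂μ, |ζ x| ≤ C) :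
    |∫ x, (ζ x * |g x| - ζ x * φ x * g x) ∂μ| ≤ C * ∫ x, (|g x| - φ x * g x) ∂μ := by
  rw [← integral_const_mul, ← Real.norm_eq_abs]
  refine norm_integral_le_of_norm_le
    ((hg.abs.sub (hg.bdd_mul (c := 1) hφ (ae_of_all _ hφ1))).const_mul C) ?_
  filter_upwards [hζ] with x hx
  have h1 : ζ x * |g x| - ζ x * φ x * g x = ζ x * (|g x| - φ x * g x) := by ring
  have h2 : 0 ≤ |g x| - φ x * g x := by
    have : |φ x * g x| ≤ 1 * |g x| := by
      rw [abs_mul]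
      exact mul_le_mul_of_nonneg_right (hφ1 x) (abs_nonneg _)
    linarith [le_abs_self (φ x * g x)]
  rw [h1, norm_mul, Real.norm_eq_abs, Real.norm_of_nonneg h2]
  exact mul_le_mul_of_nonneg_right hx h2

theorem ContDiffOn.contDiff_mul_of_tsupport_subset {d : ℕ} {Ω : Set (Space d)} (hΩo : IsOpen Ω)
    {ζ φ : Space d → ℝ} (hζ : ContDiffOn ℝ ∞ ζ Ω) (hφ : ContDiff ℝ ∞ φ)
    (hφs : tsupport φ ⊆ Ω) : ContDiff ℝ ∞ fun x => ζ x * φ x := by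
  rw [contDiff_iff_contDiffAt]
  intro x
  by_cases hx : x ∈ tsupport φ
  · exact (hζ.contDiffAt (hΩo.mem_nhds (hφs hx))).mul hφ.contDiffAt
  · refine (contDiffAt_const (c := (0 : ℝ))).congr_of_eventuallyEq ?_
    filter_upwards [(isClosed_tsupport φ).isOpen_compl.mem_nhds hx] with y hy
    rw [image_eq_zero_of_notMem_tsupport hy, mul_zero]

/-- A test function that nearly realizes the total variation of `z · Du`, and hence that of the
difference quotients of `u` in direction `z`. -/
theorem IsGradientMeasure.exists_test_increment_defect_le {d : ℕ} {Ω : Set (Space d)}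
    (hΩo : IsOpen Ω) (hΩc : Convex ℝ Ω) {u : Space d → ℝ} (hum : Measurable u)
    (hu : Integrable u) (hu0 : ∀ x ∉ Ω, u x = 0)
    {ν : VectorMeasure (Space d) (Space d)} (hν : IsGradientMeasure Ω u ν) (z : Space d)
    {η : ℝ} (hη : 0 < η) :
    ∃ φ : Space d → ℝ, ContDiff ℝ ∞ φ ∧ HasCompactSupport φ ∧ tsupport φ ⊆ Ω ∧
      (∀ x, |φ x| ≤ 1) ∧
      ∫ x, (|inner ℝ z (polarDensity ν x)| - φ x * inner ℝ z (polarDensity ν x)) ∂ν.variation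
        ≤ η ∧
      ∀ᶠ ε in 𝓝[>] (0 : ℝ), ε⁻¹ * ∫ x in translateInter Ω (ε • z),
        (|u x - u (x - ε • z)| - φ x * (u x - u (x - ε • z))) ≤ 2 * η := by
  have hw := integrable_inner_polarDensity ν z
  have hpm := measurable_polarDensity ν
  obtain ⟨φ, hφ, hφc, hφs, hφ1, hφη⟩ := exists_contDiff_setIntegral_abs_sub_le ν.variation hΩo
    (g := fun x => inner ℝ z (polarDensity ν x)) (by fun_prop) hw.integrableOn hη
  have hres : ν.variation.restrict Ω = ν.variation :=
    Measure.restrict_eq_self_of_ae_mem (by rw [ae_iff]; exact hν.2.1)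
  rw [hres] at hφη
  have hφm := hφ.continuous
  have hφw : Integrable (fun x => φ x * inner ℝ z (polarDensity ν x)) ν.variation :=
    hw.bdd_mul (c := 1) hφm.aestronglyMeasurable (ae_of_all _ hφ1)
  refine ⟨φ, hφ, hφc, hφs, hφ1, by rw [integral_sub hw.abs hφw]; linarith, ?_⟩
  have hlim := hν.tendsto_integral_mul_increment hΩo hΩc hu hu0 hφ hφc hφs z
  filter_upwards [hlim.eventually_const_lt (sub_lt_self _ hη),
    eventually_subset_translateInter hΩo hφc hφs z, self_mem_nhdsWithin]
    with ε h1 hε (hε0 : 0 < ε)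
  have hi : Integrable fun x => u x - u (x - ε • z) := hu.sub (hu.comp_sub_right _)
  have hφi : Integrable fun x => φ x * (u x - u (x - ε • z)) :=
    hi.bdd_mul (c := 1) hφm.aestronglyMeasurable (ae_of_all _ hφ1)
  rw [integral_sub hi.integrableOn.abs hφi.integrableOn]
  have h2 : ∫ x in translateInter Ω (ε • z), φ x * (u x - u (x - ε • z)) =
      ∫ x, φ x * (u x - u (x - ε • z)) :=
    setIntegral_eq_integral_of_forall_compl_eq_zero fun x hx => by
      rw [image_eq_zero_of_notMem_tsupport (fun h => hx (hε h)), zero_mul]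
  have h3 := hν.setIntegral_abs_increment_le hΩo hΩc hum hu hu0 (ε • z)
  simp only [real_inner_smul_left, abs_mul, abs_of_pos hε0] at h3
  rw [integral_const_mul] at h3
  have h4 : ε⁻¹ * ∫ x in translateInter Ω (ε • z), |u x - u (x - ε • z)| ≤
      ∫ x, |inner ℝ z (polarDensity ν x)| ∂ν.variation := by
    rwa [inv_mul_le_iff₀ hε0]
  rw [h2, mul_sub]
  linarith

/-- The absolute difference quotients of `u` in direction `z` converge to `|z · Du|`, also when
tested against functions that are smooth and bounded on `Ω`. -/
theorem IsGradientMeasure.tendsto_integral_mul_abs_increment {d : ℕ} {Ω : Set (Space d)}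
    (hΩo : IsOpen Ω) (hΩc : Convex ℝ Ω) {u : Space d → ℝ} (hum : Measurable u)
    (hu : Integrable u) (hu0 : ∀ x ∉ Ω, u x = 0)
    {ν : VectorMeasure (Space d) (Space d)} (hν : IsGradientMeasure Ω u ν)
    {ζ : Space d → ℝ} (hζ : ContDiffOn ℝ ∞ ζ Ω) {C : ℝ} (hC : 0 ≤ C)
    (hζC : ∀ x ∈ Ω, |ζ x| ≤ C) (z : Space d) :
    Tendsto (fun ε : ℝ => ε⁻¹ * ∫ x in translateInter Ω (ε • z), ζ x * |u x - u (x - ε • z)|)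
      (𝓝[>] 0) (𝓝 (∫ x, ζ x * |inner ℝ z (polarDensity ν x)| ∂ν.variation)) := by
  have hw := integrable_inner_polarDensity ν z
  have hmem : ∀ᵐ x ∂ν.variation, x ∈ Ω := by rw [ae_iff]; exact hν.2.1
  have hres : ν.variation.restrict Ω = ν.variation := Measure.restrict_eq_self_of_ae_mem hmem
  have hζb : ∀ᵐ x ∂ν.variation, |ζ x| ≤ C := hmem.mono hζC
  have hζm : AEStronglyMeasurable ζ ν.variation := by
    rw [← hres]
    exact hζ.continuousOn.aestronglyMeasurable hΩo.measurableSet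
  rw [Metric.tendsto_nhds]
  intro e he
  set η := e / (4 * (C + 1)) with hη
  have hη0 : 0 < η := by positivity
  have hCη : 3 * (C * η) ≤ 3 * (e / 4) := by
    have : C * η = e / 4 * (C / (C + 1)) := by rw [hη]; field_simp
    rw [this]
    have h1 : C / (C + 1) ≤ 1 := div_le_one_of_le₀ (by linarith) (by linarith)
    have := mul_le_of_le_one_right (by positivity : (0 : ℝ) ≤ e / 4) h1
    linarith
  obtain ⟨φ, hφ, hφc, hφs, hφ1, hφη, hev⟩ :=
    hν.exists_test_increment_defect_le hΩo hΩc hum hu hu0 z hη0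
  have hφm := hφ.continuous
  have hψ := hζ.contDiff_mul_of_tsupport_subset hΩo hφ hφs
  have hψs : tsupport (fun x => ζ x * φ x) ⊆ tsupport φ := tsupport_mul_subset_right
  have hlim := hν.tendsto_integral_mul_increment hΩo hΩc hu hu0 hψ hφc.mul_left
    (hψs.trans hφs) z
  rw [Metric.tendsto_nhds] at hlim
  filter_upwards [hev, hlim (e / 4) (by positivity),
    eventually_subset_translateInter hΩo hφc hφs z, self_mem_nhdsWithin]
    with ε h1 h2 hε (hε0 : 0 < ε)
  have hi : Integrable fun x => u x - u (x - ε • z) := hu.sub (hu.comp_sub_right _)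
  have hmeas := (hΩo.translateInter (ε • z)).measurableSet
  have hA := abs_integral_mul_abs_sub_le (μ := volume.restrict (translateInter Ω (ε • z)))
    (g := fun x => u x - u (x - ε • z)) (φ := φ) (ζ := ζ) hi.integrableOn
    hφm.aestronglyMeasurable hφ1
    ((ae_restrict_mem hmeas).mono fun x hx => hζC x hx.1)
  have hE := abs_integral_mul_abs_sub_le (μ := ν.variation) (φ := φ) (ζ := ζ) hw
    hφm.aestronglyMeasurable hφ1 hζb
  have hψb : ∀ x, |ζ x * φ x| ≤ C := by
    intro x
    by_cases hx : x ∈ Ω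
    · rw [abs_mul]
      exact (mul_le_of_le_one_right (abs_nonneg _) (hφ1 x)).trans (hζC x hx)
    · rw [image_eq_zero_of_notMem_tsupport (fun h => hx (hφs h)), mul_zero, abs_zero]
      exact hC
  have hζm' : AEStronglyMeasurable ζ (volume.restrict (translateInter Ω (ε • z))) :=
    (hζ.continuousOn.mono fun x hx => hx.1).aestronglyMeasurable hmeas
  rw [integral_sub
    (hi.integrableOn.abs.bdd_mul (c := C) hζm'
      ((ae_restrict_mem hmeas).mono fun x hx => hζC x hx.1))
    (hi.integrableOn.bdd_mul (c := C) hψ.continuous.aestronglyMeasurable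
      (ae_of_all _ hψb))] at hA
  rw [integral_sub (hw.abs.bdd_mul (c := C) hζm hζb)
    (hw.bdd_mul (c := C) hψ.continuous.aestronglyMeasurable (ae_of_all _ hψb))] at hE
  have h3 : ∫ x in translateInter Ω (ε • z), ζ x * φ x * (u x - u (x - ε • z)) =
      ∫ x, ζ x * φ x * (u x - u (x - ε • z)) :=
    setIntegral_eq_integral_of_forall_compl_eq_zero fun x hx => by
      rw [image_eq_zero_of_notMem_tsupport (fun h => hx (hε h)), mul_zero, zero_mul]
  rw [h3] at hA
  rw [Real.dist_eq] at h2 ⊢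
  have hA' := mul_le_mul_of_nonneg_left hA (inv_pos.2 hε0).le
  rw [← abs_of_pos (inv_pos.2 hε0), ← abs_mul, abs_of_pos (inv_pos.2 hε0), mul_sub] at hA'
  have hA2 := mul_le_mul_of_nonneg_left h1 hC
  have hE2 := mul_le_mul_of_nonneg_left hφη hC
  have e1 := abs_le.1 hA'
  have e2 := abs_lt.1 h2
  have e3 := abs_le.1 hE
  rw [mul_left_comm] at e1
  rw [abs_lt]
  constructor <;> linarith [e1.1, e1.2, e2.1, e2.2, e3.1, e3.2]

/-- Replacing `ζ` by a translate of size `ε` is negligible against the difference quotients. -/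
theorem IsGradientMeasure.tendsto_integral_translate_sub_mul_abs_increment {d : ℕ}
    {Ω : Set (Space d)} (hΩo : IsOpen Ω) (hΩc : Convex ℝ Ω) {u : Space d → ℝ}
    (hum : Measurable u) (hu : Integrable u) (hu0 : ∀ x ∉ Ω, u x = 0)
    {ν : VectorMeasure (Space d) (Space d)} (hν : IsGradientMeasure Ω u ν)
    {ζ : Space d → ℝ} (hζ : ContinuousOn ζ Ω) {C : ℝ} (hC : 0 ≤ C)
    (hζC : ∀ x ∈ Ω, |ζ x| ≤ C) (z : Space d) :
    Tendsto (fun ε : ℝ => ε⁻¹ * ∫ x in translateInter Ω (ε • z),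
      |ζ (x - ε • z) - ζ x| * |u x - u (x - ε • z)|) (𝓝[>] 0) (𝓝 0) := by
  set T := ∫ x, |inner ℝ z (polarDensity ν x)| ∂ν.variation with hT
  have hT0 : 0 ≤ T := integral_nonneg fun _ => abs_nonneg _
  rw [Metric.tendsto_nhds]
  intro e he
  set η := e / (8 * (C + 1)) with hη
  have hη0 : 0 < η := by positivity
  have hCη : 2 * C * (2 * η) ≤ e / 2 := by
    have : C * η = e / 8 * (C / (C + 1)) := by rw [hη]; field_simp
    have h1 : C / (C + 1) ≤ 1 := div_le_one_of_le₀ (by linarith) (by linarith)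
    have := mul_le_of_le_one_right (by positivity : (0 : ℝ) ≤ e / 8) h1
    linarith
  set θ := e / (4 * (T + 1)) with hθ
  have hθ0 : 0 < θ := by positivity
  have hTθ : θ * T ≤ e / 4 := by
    have : θ * T = e / 4 * (T / (T + 1)) := by rw [hθ]; field_simp
    rw [this]
    exact mul_le_of_le_one_right (by positivity) (div_le_one_of_le₀ (by linarith) (by linarith))
  obtain ⟨φ, hφ, hφc, hφs, hφ1, hφη, hev⟩ :=
    hν.exists_test_increment_defect_le hΩo hΩc hum hu hu0 z hη0
  have hφm := hφ.continuous
  have hclose : ∀ᶠ ε in 𝓝[>] (0 : ℝ), ∀ x ∈ tsupport φ, |ζ (x - ε • z) - ζ x| ≤ θ := by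
    have h1 := IsCompact.uniformContinuousAt_of_continuousAt hφc ζ
      (fun x hx => hζ.continuousAt (hΩo.mem_nhds (hφs hx))) (Metric.dist_mem_uniformity hθ0)
    obtain ⟨δ, hδ, hδθ⟩ := Metric.mem_uniformity_dist.1 h1
    have h2 : Tendsto (fun ε : ℝ => ‖ε • z‖) (𝓝[>] 0) (𝓝 0) := by
      have : Continuous fun ε : ℝ => ‖ε • z‖ := by fun_prop
      simpa using this.continuousWithinAt (s := Ioi 0) (x := 0) |>.tendsto
    filter_upwards [h2.eventually_lt_const hδ] with ε hε x hx
    have h3 := hδθ (a := x) (b := x - ε • z) (by simpa [dist_eq_norm] using hε) hx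
    rw [abs_sub_comm]
    exact (show |ζ x - ζ (x - ε • z)| < θ from h3).le
  filter_upwards [hev, hclose, self_mem_nhdsWithin] with ε h1 h2 (hε0 : 0 < ε)
  have hi : Integrable fun x => u x - u (x - ε • z) := hu.sub (hu.comp_sub_right _)
  have hmeas := (hΩo.translateInter (ε • z)).measurableSet
  have hφi : Integrable fun x => φ x * (u x - u (x - ε • z)) :=
    hi.bdd_mul (c := 1) hφm.aestronglyMeasurable (ae_of_all _ hφ1)
  have hdi : Integrable (fun x => |u x - u (x - ε • z)| - φ x * (u x - u (x - ε • z)))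
      (volume.restrict (translateInter Ω (ε • z))) := hi.integrableOn.abs.sub hφi.integrableOn
  have hle : ∫ x in translateInter Ω (ε • z), |ζ (x - ε • z) - ζ x| * |u x - u (x - ε • z)| ≤
      ∫ x in translateInter Ω (ε • z), (θ * |u x - u (x - ε • z)| +
        2 * C * (|u x - u (x - ε • z)| - φ x * (u x - u (x - ε • z)))) := by
    refine integral_mono_of_nonneg (ae_of_all _ fun x => by positivity)
      ((hi.integrableOn.abs.const_mul θ).add
        (hdi.const_mul _)) ?_
    filter_upwards [ae_restrict_mem hmeas] with x hx
    have h0 : 0 ≤ |u x - u (x - ε • z)| - φ x * (u x - u (x - ε • z)) := by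
      have : |φ x * (u x - u (x - ε • z))| ≤ 1 * |u x - u (x - ε • z)| := by
        rw [abs_mul]
        exact mul_le_mul_of_nonneg_right (hφ1 x) (abs_nonneg _)
      linarith [le_abs_self (φ x * (u x - u (x - ε • z)))]
    by_cases hxφ : x ∈ tsupport φ
    · have := mul_le_mul_of_nonneg_right (h2 x hxφ) (abs_nonneg (u x - u (x - ε • z)))
      have := mul_nonneg (mul_nonneg zero_le_two hC) h0
      linarith
    · rw [image_eq_zero_of_notMem_tsupport hxφ, zero_mul, sub_zero]
      have h3 : |ζ (x - ε • z) - ζ x| ≤ 2 * C := by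
        have := abs_sub (ζ (x - ε • z)) (ζ x)
        linarith [hζC _ hx.1, hζC _ hx.2]
      have := mul_le_mul_of_nonneg_right h3 (abs_nonneg (u x - u (x - ε • z)))
      have := mul_nonneg hθ0.le (abs_nonneg (u x - u (x - ε • z)))
      linarith
  rw [integral_add (hi.integrableOn.abs.const_mul θ)
    (hdi.const_mul _), integral_const_mul,
    integral_const_mul] at hle
  have h3 := hν.setIntegral_abs_increment_le hΩo hΩc hum hu hu0 (ε • z)
  simp only [real_inner_smul_left, abs_mul, abs_of_pos hε0] at h3
  rw [integral_const_mul, ← inv_mul_le_iff₀ hε0] at h3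
  have hle' := mul_le_mul_of_nonneg_left hle (inv_pos.2 hε0).le
  rw [mul_add, mul_left_comm, mul_left_comm _ (2 * C)] at hle'
  have e1 := mul_le_mul_of_nonneg_left h3 hθ0.le
  have e2 := mul_le_mul_of_nonneg_left h1 (mul_nonneg zero_le_two hC)
  rw [Real.dist_eq, sub_zero, abs_of_nonneg (mul_nonneg (inv_pos.2 hε0).le
    (integral_nonneg fun x => by positivity))]
  linarith

/-! ### Integrability of kernels of rapid decay -/

theorem MvPolynomial.exists_abs_eval_le {d : ℕ} (P : MvPolynomial (Fin d) ℝ) :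
    ∃ (A : ℝ) (n : ℕ), 0 ≤ A ∧
      ∀ z : Space d, |MvPolynomial.eval (fun i => z i) P| ≤ A * (1 + ‖z‖) ^ n := by
  induction P using MvPolynomial.induction_on with
  | C a => exact ⟨|a|, 0, abs_nonneg a, fun z => by simp⟩
  | add p q hp hq =>
    obtain ⟨A, n, hA, hp⟩ := hp
    obtain ⟨B, m, hB, hq⟩ := hq
    refine ⟨A + B, max n m, add_nonneg hA hB, fun z => ?_⟩
    have h1 : (1 : ℝ) ≤ 1 + ‖z‖ := by linarith [norm_nonneg z]
    rw [map_add, add_mul]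
    refine (abs_add_le _ _).trans (add_le_add ((hp z).trans ?_) ((hq z).trans ?_))
    · exact mul_le_mul_of_nonneg_left (pow_le_pow_right₀ h1 (le_max_left _ _)) hA
    · exact mul_le_mul_of_nonneg_left (pow_le_pow_right₀ h1 (le_max_right _ _)) hB
  | mul_X p i hp =>
    obtain ⟨A, n, hA, hp⟩ := hp
    refine ⟨A, n + 1, hA, fun z => ?_⟩
    rw [map_mul, MvPolynomial.eval_X, abs_mul, pow_succ, ← mul_assoc]
    have h1 : |z i| ≤ ‖z‖ := PiLp.norm_apply_le z i
    exact mul_le_mul (hp z) (by linarith) (abs_nonneg _) (by positivity)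

theorem HasRapidDecay.integrable_mul_one_add_norm {d : ℕ} {J : Space d → ℝ} (hJm : Measurable J)
    (hJ0 : ∀ z, 0 ≤ J z) (hJ : HasRapidDecay J) : Integrable fun z => J z * (1 + ‖z‖) := by
  obtain ⟨P, hP⟩ := hJ
  obtain ⟨A, n, hA, hPA⟩ := P.exists_abs_eval_le
  set c : ℝ := ((4 * Real.pi) ^ ((d : ℝ) / 2))⁻¹ with hc
  have hc0 : 0 ≤ c := by positivity
  have hint : Integrable fun z : Space d => Real.exp (-(1 / 8) * ‖z‖ ^ 2) := by
    have h1 := (GaussianFourier.integrable_cexp_neg_mul_sq_norm_add (V := Space d)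
      (b := (1 / 8 : ℂ)) (by norm_num) 0 0).norm
    refine h1.congr (ae_of_all _ fun z => ?_)
    simp only [Complex.norm_exp]
    congr 1
    simp only [zero_mul, add_zero]
    norm_cast
    simp [-Complex.ofReal_pow]
  refine (hint.const_mul (A * c * (Real.exp 3 * (n + 1).factorial))).mono'
    (by fun_prop) (ae_of_all _ fun z => ?_)
  have hr := norm_nonneg z
  rw [Real.norm_of_nonneg (mul_nonneg (hJ0 z) (by positivity))]
  have h1 : (1 + ‖z‖) ^ (n + 1) ≤ (n + 1).factorial * Real.exp (1 + ‖z‖) := by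
    have := Real.pow_div_factorial_le_exp (1 + ‖z‖) (by positivity) (n + 1)
    rwa [div_le_iff₀' (by positivity)] at this
  have h2 : Real.exp (1 + ‖z‖) * Real.exp (-(‖z‖ ^ 2) / 4) ≤
      Real.exp 3 * Real.exp (-(1 / 8) * ‖z‖ ^ 2) := by
    rw [← Real.exp_add, ← Real.exp_add]
    exact Real.exp_le_exp.2 (by nlinarith [sq_nonneg (‖z‖ - 4)])
  calc J z * (1 + ‖z‖)
      ≤ (A * (1 + ‖z‖) ^ n * (c * Real.exp (-(‖z‖ ^ 2) / 4))) * (1 + ‖z‖) := by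
        refine mul_le_mul_of_nonneg_right ((hP z).trans ?_) (by positivity)
        exact mul_le_mul_of_nonneg_right (hPA z) (by unfold heatKernelOne; positivity)
    _ = A * c * (1 + ‖z‖) ^ (n + 1) * Real.exp (-(‖z‖ ^ 2) / 4) := by ring
    _ ≤ A * c * ((n + 1).factorial * Real.exp (1 + ‖z‖)) * Real.exp (-(‖z‖ ^ 2) / 4) := by
        gcongr
    _ = A * c * (n + 1).factorial * (Real.exp (1 + ‖z‖) * Real.exp (-(‖z‖ ^ 2) / 4)) := by ring
    _ ≤ A * c * (n + 1).factorial * (Real.exp 3 * Real.exp (-(1 / 8) * ‖z‖ ^ 2)) := by gcongr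
    _ = _ := by ring

theorem HasRapidDecay.integrable {d : ℕ} {J : Space d → ℝ} (hJm : Measurable J)
    (hJ0 : ∀ z, 0 ≤ J z) (hJ : HasRapidDecay J) : Integrable J := by
  refine (hJ.integrable_mul_one_add_norm hJm hJ0).mono' hJm.aestronglyMeasurable
    (ae_of_all _ fun z => ?_)
  rw [Real.norm_of_nonneg (hJ0 z)]
  exact le_mul_of_one_le_right (hJ0 z) (by linarith [norm_nonneg z])

theorem HasRapidDecay.integrable_mul_norm {d : ℕ} {J : Space d → ℝ} (hJm : Measurable J)
    (hJ0 : ∀ z, 0 ≤ J z) (hJ : HasRapidDecay J) : Integrable fun z => J z * ‖z‖ := by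
  refine (hJ.integrable_mul_one_add_norm hJm hJ0).mono' (by fun_prop) (ae_of_all _ fun z => ?_)
  rw [Real.norm_of_nonneg (mul_nonneg (hJ0 z) (norm_nonneg z))]
  exact mul_le_mul_of_nonneg_left (by linarith) (hJ0 z)

/-! ### Interaction of two disjoint phases -/

theorem abs_mul_le_abs_sub_of_disjoint {α : Type*} {r₁ r₂ : α → ℝ}
    (h₁ : ∀ x, r₁ x = 0 ∨ r₁ x = 1) (h₂ : ∀ x, r₂ x = 0 ∨ r₂ x = 1)
    (h₁₂ : ∀ x, r₁ x * r₂ x = 0) (x y : α) : |r₁ x * r₂ y| ≤ |r₁ x - r₁ y| := by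
  have h := h₁₂ y
  rcases h₁ x with hx | hx <;> rcases h₁ y with hy | hy <;> rcases h₂ y with hz | hz <;>
    simp_all

theorem mul_add_mul_eq_of_disjoint {α : Type*} {r₁ r₂ : α → ℝ}
    (h₁ : ∀ x, r₁ x = 0 ∨ r₁ x = 1) (h₂ : ∀ x, r₂ x = 0 ∨ r₂ x = 1)
    (h₁₂ : ∀ x, r₁ x * r₂ x = 0) (x y : α) :
    r₁ x * r₂ y + r₁ y * r₂ x = 1 / 2 * (|r₁ x - r₁ y| + |r₂ x - r₂ y| -
      |(r₁ + r₂) x - (r₁ + r₂) y|) := by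
  have hx' := h₁₂ x
  have hy' := h₁₂ y
  simp only [Pi.add_apply]
  rcases h₁ x with hx | hx <;> rcases h₁ y with hy | hy <;> rcases h₂ x with hw | hw <;>
    rcases h₂ y with hz | hz <;> rw [hx, hw] at hx' <;> rw [hy, hz] at hy' <;>
    rw [hx, hy, hw, hz] <;> norm_num at hx' <;> norm_num at hy' <;> norm_num

/-- The part of the interaction energy of `r₁` and `r₂` that comes from points at distance
`ε • z`. -/
noncomputable def interactionQuotient {d : ℕ} (ζ r₁ r₂ : Space d → ℝ) (ε : ℝ) (z : Space d) : ℝ :=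
  ε⁻¹ * ∫ x, ζ x * (r₁ x * r₂ (x - ε • z))

theorem abs_interactionQuotient_le {d : ℕ} {Ω : Set (Space d)}
    (hΩo : IsOpen Ω) (hΩc : Convex ℝ Ω) {r₁ r₂ : Space d → ℝ} (hm₁ : Measurable r₁)
    (hi₁ : Integrable r₁) (h₁ : ∀ x, r₁ x = 0 ∨ r₁ x = 1) (h₂ : ∀ x, r₂ x = 0 ∨ r₂ x = 1)
    (h₁₂ : ∀ x, r₁ x * r₂ x = 0) (h0₁ : ∀ x ∉ Ω, r₁ x = 0) (h0₂ : ∀ x ∉ Ω, r₂ x = 0)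
    {ν₁ : VectorMeasure (Space d) (Space d)} (hν₁ : IsGradientMeasure Ω r₁ ν₁)
    {ζ : Space d → ℝ} {C : ℝ} (hC : 0 ≤ C) (hζC : ∀ x ∈ Ω, |ζ x| ≤ C) {ε : ℝ} (hε : 0 < ε)
    (z : Space d) :
    |interactionQuotient ζ r₁ r₂ ε z| ≤
      C * ((∫ x, ‖polarDensity ν₁ x‖ ∂ν₁.variation) * ‖z‖) := by
  have hmeas := (hΩo.translateInter (ε • z)).measurableSet
  have h3 := hν₁.setIntegral_abs_increment_le hΩo hΩc hm₁ hi₁ h0₁ (ε • z)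
  simp only [real_inner_smul_left, abs_mul, abs_of_pos hε] at h3
  rw [integral_const_mul, ← inv_mul_le_iff₀ hε] at h3
  have h4 : ∫ x, |inner ℝ z (polarDensity ν₁ x)| ∂ν₁.variation ≤
      (∫ x, ‖polarDensity ν₁ x‖ ∂ν₁.variation) * ‖z‖ := by
    rw [← integral_mul_const]
    refine integral_mono (integrable_inner_polarDensity ν₁ z).abs
      ((integrable_polarDensity ν₁).norm.mul_const _) fun x => ?_
    rw [mul_comm]
    exact abs_real_inner_le_norm _ _
  have hi : Integrable fun x => r₁ x - r₁ (x - ε • z) := hi₁.sub (hi₁.comp_sub_right _)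
  have h5 : |∫ x, ζ x * (r₁ x * r₂ (x - ε • z))| ≤
      C * ∫ x in translateInter Ω (ε • z), |r₁ x - r₁ (x - ε • z)| := by
    rw [← integral_indicator hmeas, ← integral_const_mul, ← Real.norm_eq_abs]
    refine norm_integral_le_of_norm_le ((hi.abs.indicator hmeas).const_mul C)
      (ae_of_all _ fun x => ?_)
    by_cases hx : x ∈ translateInter Ω (ε • z)
    · rw [indicator_of_mem hx, norm_mul]
      exact mul_le_mul (hζC x hx.1) (abs_mul_le_abs_sub_of_disjoint h₁ h₂ h₁₂ _ _)
        (norm_nonneg _) hC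
    · rw [indicator_of_notMem hx]
      by_cases hx' : x ∈ Ω
      · rw [h0₂ (x - ε • z) fun h => hx ⟨hx', h⟩]
        simp
      · rw [h0₁ x hx']
        simp
  rw [interactionQuotient, abs_mul, abs_of_pos (inv_pos.2 hε)]
  calc ε⁻¹ * |∫ x, ζ x * (r₁ x * r₂ (x - ε • z))|
      ≤ ε⁻¹ * (C * ∫ x in translateInter Ω (ε • z), |r₁ x - r₁ (x - ε • z)|) :=
        mul_le_mul_of_nonneg_left h5 (inv_pos.2 hε).le
    _ = C * (ε⁻¹ * ∫ x in translateInter Ω (ε • z), |r₁ x - r₁ (x - ε • z)|) := by ring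
    _ ≤ _ := mul_le_mul_of_nonneg_left (h3.trans h4) hC

theorem tendsto_interactionQuotient_add_neg {d : ℕ} {Ω : Set (Space d)}
    (hΩo : IsOpen Ω) (hΩc : Convex ℝ Ω) {r₁ r₂ : Space d → ℝ} (hm₁ : Measurable r₁)
    (hm₂ : Measurable r₂) (hi₁ : Integrable r₁) (hi₂ : Integrable r₂)
    (h₁ : ∀ x, r₁ x = 0 ∨ r₁ x = 1) (h₂ : ∀ x, r₂ x = 0 ∨ r₂ x = 1)
    (h₁₂ : ∀ x, r₁ x * r₂ x = 0) (h0₁ : ∀ x ∉ Ω, r₁ x = 0) (h0₂ : ∀ x ∉ Ω, r₂ x = 0)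
    {ν₁ ν₂ ν : VectorMeasure (Space d) (Space d)} (hν₁ : IsGradientMeasure Ω r₁ ν₁)
    (hν₂ : IsGradientMeasure Ω r₂ ν₂) (hν : IsGradientMeasure Ω (r₁ + r₂) ν)
    {ζ : Space d → ℝ} (hζ : ContDiffOn ℝ ∞ ζ Ω) {C : ℝ} (hC : 0 ≤ C)
    (hζC : ∀ x ∈ Ω, |ζ x| ≤ C) (z : Space d) :
    Tendsto (fun ε : ℝ => interactionQuotient ζ r₁ r₂ ε z + interactionQuotient ζ r₁ r₂ ε (-z))
      (𝓝[>] 0) (𝓝 (1 / 2 * ((∫ x, ζ x * |inner ℝ z (polarDensity ν₁ x)| ∂ν₁.variation) +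
        (∫ x, ζ x * |inner ℝ z (polarDensity ν₂ x)| ∂ν₂.variation) -
        ∫ x, ζ x * |inner ℝ z (polarDensity ν x)| ∂ν.variation))) := by
  have L₁ := hν₁.tendsto_integral_mul_abs_increment hΩo hΩc hm₁ hi₁ h0₁ hζ hC hζC z
  have L₂ := hν₂.tendsto_integral_mul_abs_increment hΩo hΩc hm₂ hi₂ h0₂ hζ hC hζC z
  have L := hν.tendsto_integral_mul_abs_increment hΩo hΩc (hm₁.add hm₂) (hi₁.add hi₂)
    (fun x hx => by simp [h0₁ x hx, h0₂ x hx]) hζ hC hζC z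
  have R := hν₁.tendsto_integral_translate_sub_mul_abs_increment hΩo hΩc hm₁ hi₁ h0₁
    hζ.continuousOn hC hζC z
  have hR : Tendsto (fun ε : ℝ => ε⁻¹ * ∫ x in translateInter Ω (ε • z),
      (ζ (x - ε • z) - ζ x) * (r₁ (x - ε • z) * r₂ x)) (𝓝[>] 0) (𝓝 0) := by
    refine squeeze_zero_norm' ?_ R
    filter_upwards [self_mem_nhdsWithin] with ε (hε0 : 0 < ε)
    have hmeas := (hΩo.translateInter (ε • z)).measurableSet
    have hi : Integrable fun x => r₁ x - r₁ (x - ε • z) := hi₁.sub (hi₁.comp_sub_right _)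
    have hs : ContinuousOn (fun x => ζ (x - ε • z)) (translateInter Ω (ε • z)) :=
      hζ.continuousOn.comp (by fun_prop) fun x hx => hx.2
    have hs' : ContinuousOn ζ (translateInter Ω (ε • z)) :=
      hζ.continuousOn.mono fun x hx => hx.1
    rw [norm_mul, Real.norm_of_nonneg (inv_pos.2 hε0).le]
    refine mul_le_mul_of_nonneg_left (norm_integral_le_of_norm_le ?_ (ae_of_all _ fun x => ?_))
      (inv_pos.2 hε0).le
    · refine Integrable.bdd_mul (c := 2 * C) hi.abs.integrableOn
        ((hs.sub hs').abs.aestronglyMeasurable hmeas) ?_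
      filter_upwards [ae_restrict_mem hmeas] with x hx
      have := abs_sub (ζ (x - ε • z)) (ζ x)
      rw [Real.norm_eq_abs, abs_abs]
      linarith [hζC _ hx.1, hζC _ hx.2]
    · rw [norm_mul, Real.norm_eq_abs, abs_sub_comm (r₁ x)]
      exact mul_le_mul_of_nonneg_left (abs_mul_le_abs_sub_of_disjoint h₁ h₂ h₁₂ _ _)
        (abs_nonneg _)
  have hlim := (((L₁.add L₂).sub L).const_mul (1 / 2)).add hR
  rw [add_zero] at hlim
  refine hlim.congr fun ε => ?_
  have hmeas := (hΩo.translateInter (ε • z)).measurableSet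
  have hs : ContinuousOn (fun x => ζ (x - ε • z)) (translateInter Ω (ε • z)) :=
    hζ.continuousOn.comp (by fun_prop) fun x hx => hx.2
  have hs' : ContinuousOn ζ (translateInter Ω (ε • z)) :=
    hζ.continuousOn.mono fun x hx => hx.1
  have hb : ∀ᵐ x ∂volume.restrict (translateInter Ω (ε • z)), ‖ζ x‖ ≤ C :=
    (ae_restrict_mem hmeas).mono fun x hx => hζC x hx.1
  have hb' : ∀ᵐ x ∂volume.restrict (translateInter Ω (ε • z)), ‖ζ (x - ε • z)‖ ≤ C :=
    (ae_restrict_mem hmeas).mono fun x hx => hζC _ hx.2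
  have habs : ∀ u : Space d → ℝ, Integrable u →
      Integrable (fun x => ζ x * |u x - u (x - ε • z)|)
        (volume.restrict (translateInter Ω (ε • z))) := fun u hu =>
    (hu.sub (hu.comp_sub_right (ε • z))).abs.integrableOn.bdd_mul (c := C)
      (hs'.aestronglyMeasurable hmeas) hb
  have hr₁b : ∀ x, ‖r₁ x‖ ≤ 1 := fun x => by rcases h₁ x with h | h <;> simp [h]
  have hr₂b : ∀ x, ‖r₂ x‖ ≤ 1 := fun x => by rcases h₂ x with h | h <;> simp [h]
  have p₁ : Integrable fun x => r₁ x * r₂ (x - ε • z) :=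
    hi₁.mul_bdd (c := 1) (Measurable.aestronglyMeasurable (by fun_prop))
      (ae_of_all _ fun x => hr₂b _)
  have p₂ : Integrable fun x => r₁ (x - ε • z) * r₂ x :=
    hi₂.bdd_mul (c := 1) (Measurable.aestronglyMeasurable (by fun_prop))
      (ae_of_all _ fun x => hr₁b _)
  have i₁ : Integrable (fun x => ζ x * (r₁ x * r₂ (x - ε • z)))
      (volume.restrict (translateInter Ω (ε • z))) :=
    p₁.integrableOn.bdd_mul (c := C) (hs'.aestronglyMeasurable hmeas) hb
  have i₂ : Integrable (fun x => ζ (x - ε • z) * (r₁ (x - ε • z) * r₂ x))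
      (volume.restrict (translateInter Ω (ε • z))) :=
    p₂.integrableOn.bdd_mul (c := C) (hs.aestronglyMeasurable hmeas) hb'
  have i₃ : Integrable (fun x => ζ x * (r₁ (x - ε • z) * r₂ x))
      (volume.restrict (translateInter Ω (ε • z))) :=
    p₂.integrableOn.bdd_mul (c := C) (hs'.aestronglyMeasurable hmeas) hb
  have e₁ : interactionQuotient ζ r₁ r₂ ε z =
      ε⁻¹ * ∫ x in translateInter Ω (ε • z), ζ x * (r₁ x * r₂ (x - ε • z)) := by
    rw [interactionQuotient, setIntegral_eq_integral_of_forall_compl_eq_zero]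
    intro x hx
    by_cases hx' : x ∈ Ω
    · rw [h0₂ (x - ε • z) fun h => hx ⟨hx', h⟩]
      simp
    · rw [h0₁ x hx']
      simp
  have e₂ : interactionQuotient ζ r₁ r₂ ε (-z) =
      ε⁻¹ * ∫ x in translateInter Ω (ε • z), ζ (x - ε • z) * (r₁ (x - ε • z) * r₂ x) := by
    rw [interactionQuotient, setIntegral_eq_integral_of_forall_compl_eq_zero,
      ← integral_sub_right_eq_self _ (ε • z)]
    · simp
    intro x hx
    by_cases hx' : x ∈ Ω
    · rw [h0₁ (x - ε • z) fun h => hx ⟨hx', h⟩]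
      simp
    · rw [h0₂ x hx']
      simp
  rw [e₁, e₂, ← mul_add, ← mul_sub, mul_left_comm, ← mul_add, ← mul_add]
  congr 1
  have j₁ := habs r₁ hi₁
  have j₂ := habs r₂ hi₂
  have j := habs (r₁ + r₂) (hi₁.add hi₂)
  have j₁₂ : Integrable (fun x => ζ x * |r₁ x - r₁ (x - ε • z)| +
      ζ x * |r₂ x - r₂ (x - ε • z)|) (volume.restrict (translateInter Ω (ε • z))) := j₁.add j₂
  have i₅ := (j₁₂.sub j).const_mul (1 / 2)
  simp only [Pi.sub_apply] at i₅
  have i₄ : Integrable (fun x => (ζ (x - ε • z) - ζ x) * (r₁ (x - ε • z) * r₂ x))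
      (volume.restrict (translateInter Ω (ε • z))) := by
    simp only [sub_mul]
    exact i₂.sub i₃
  rw [← integral_add j₁ j₂, ← integral_sub j₁₂ j, ← integral_const_mul, ← integral_add i₁ i₂,
    ← integral_add i₅ i₄]
  refine integral_congr_ae (ae_of_all _ fun x => ?_)
  have := mul_add_mul_eq_of_disjoint h₁ h₂ h₁₂ x (x - ε • z)
  simp only [Pi.add_apply] at this ⊢
  linear_combination -ζ x * this

theorem IsBVZeroOne.exists_disjoint_representatives {d : ℕ} {Ω : Set (Space d)}
    (hΩo : IsOpen Ω) {ρ₁ ρ₂ : Space d → ℝ} (hρ₁ : IsBVZeroOne Ω ρ₁) (hρ₂ : IsBVZeroOne Ω ρ₂)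
    (hdisj : ∀ᵐ x ∂volume.restrict Ω, ρ₁ x * ρ₂ x = 0) :
    ∃ r₁ r₂ : Space d → ℝ, Measurable r₁ ∧ Measurable r₂ ∧ (∀ x, r₁ x = 0 ∨ r₁ x = 1) ∧
      (∀ x, r₂ x = 0 ∨ r₂ x = 1) ∧ (∀ x, r₁ x * r₂ x = 0) ∧ (∀ x ∉ Ω, r₁ x = 0) ∧
      (∀ x ∉ Ω, r₂ x = 0) ∧ ρ₁ =ᵐ[volume.restrict Ω] r₁ ∧ ρ₂ =ᵐ[volume.restrict Ω] r₂ := by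
  classical
  have m₁ := hρ₁.1.1.aestronglyMeasurable
  have m₂ := hρ₂.1.1.aestronglyMeasurable
  have hE₁ : MeasurableSet (Ω ∩ {x | m₁.mk ρ₁ x = 1}) := hΩo.measurableSet.inter
    (m₁.stronglyMeasurable_mk.measurable (measurableSet_singleton 1))
  have hE₂ : MeasurableSet ((Ω ∩ {x | m₂.mk ρ₂ x = 1}) \ (Ω ∩ {x | m₁.mk ρ₁ x = 1})) :=
    (hΩo.measurableSet.inter
      (m₂.stronglyMeasurable_mk.measurable (measurableSet_singleton 1))).diff hE₁
  refine ⟨(Ω ∩ {x | m₁.mk ρ₁ x = 1}).indicator fun _ => 1,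
    ((Ω ∩ {x | m₂.mk ρ₂ x = 1}) \ (Ω ∩ {x | m₁.mk ρ₁ x = 1})).indicator fun _ => 1,
    measurable_const.indicator hE₁, measurable_const.indicator hE₂, fun x => ?_, fun x => ?_,
    fun x => ?_, fun x hx => indicator_of_notMem (fun h => hx h.1) _,
    fun x hx => indicator_of_notMem (fun h => hx h.1.1) _, ?_, ?_⟩
  · exact (indicator_eq_zero_or_self _ _ x).imp id id
  · exact (indicator_eq_zero_or_self _ _ x).imp id id
  · by_cases hx : x ∈ Ω ∩ {x | m₁.mk ρ₁ x = 1}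
    · have hx' : x ∉ (Ω ∩ {x | m₂.mk ρ₂ x = 1}) \ (Ω ∩ {x | m₁.mk ρ₁ x = 1}) :=
        fun h => h.2 hx
      rw [indicator_of_notMem hx', mul_zero]
    · rw [indicator_of_notMem hx, zero_mul]
  · filter_upwards [m₁.ae_eq_mk, hρ₁.2, ae_restrict_mem hΩo.measurableSet] with x h1 h2 hx
    rcases h2 with h2 | h2
    · rw [indicator_of_notMem, h2]
      rintro ⟨-, h : m₁.mk ρ₁ x = 1⟩
      rw [← h1, h2] at h
      exact zero_ne_one h
    · rw [indicator_of_mem, h2]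
      exact ⟨hx, h1.symm.trans h2⟩
  · filter_upwards [m₁.ae_eq_mk, m₂.ae_eq_mk, hρ₂.2, hdisj, ae_restrict_mem hΩo.measurableSet]
      with x h1 h2 h3 h4 hx
    rcases h3 with h3 | h3
    · rw [indicator_of_notMem, h3]
      rintro ⟨⟨-, h : m₂.mk ρ₂ x = 1⟩, -⟩
      rw [← h2, h3] at h
      exact zero_ne_one h
    · rw [indicator_of_mem, h3]
      refine ⟨⟨hx, h2.symm.trans h3⟩, ?_⟩
      rintro ⟨-, h : m₁.mk ρ₁ x = 1⟩
      rw [← h1] at h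
      rw [h, h3] at h4
      norm_num at h4

theorem kernelConvolution_eq {d : ℕ} {Ω : Set (Space d)} (hΩo : IsOpen Ω) (J : Space d → ℝ)
    {ρ r : Space d → ℝ} (hr0 : ∀ x ∉ Ω, r x = 0) (hρ : ρ =ᵐ[volume.restrict Ω] r) {ε : ℝ}
    (hε : 0 < ε) (x : Space d) :
    kernelConvolution Ω J ε ρ x = ε⁻¹ * ∫ z, J z * r (x - ε • z) := by
  have h1 : Ω.indicator ρ =ᵐ[volume] r := by
    have h2 := (ae_eq_restrict_iff_indicator_ae_eq hΩo.measurableSet).1 hρ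
    rwa [indicator_eq_self.2 fun x hx => by_contra fun h => hx (hr0 x h)] at h2
  have h2 : kernelConvolution Ω J ε ρ x = ∫ t, (ε ^ (d + 1))⁻¹ *
      (J (ε⁻¹ • t) * r (x - ε • ε⁻¹ • t)) := by
    rw [kernelConvolution, convolution_congr _ EventuallyEq.rfl h1, convolution_def]
    congr 1
    ext t
    rw [ContinuousLinearMap.lsmul_apply, smul_eq_mul, rescaledKernel, smul_inv_smul₀ hε.ne',
      mul_assoc]
  rw [h2, integral_const_mul,
    Measure.integral_comp_inv_smul_of_nonneg volume (fun z => J z * r (x - ε • z)) hε.le,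
    finrank_euclideanSpace_fin, smul_eq_mul, ← mul_assoc, pow_succ]
  congr 1
  field_simp

theorem integral_kernelConvolution_eq {d : ℕ} {Ω : Set (Space d)} (hΩo : IsOpen Ω)
    {J : Space d → ℝ} (hJ : Integrable J) {ρ₁ ρ₂ r₁ r₂ : Space d → ℝ}
    (hm₂ : Measurable r₂) (hi₁ : Integrable r₁)
    (h₂ : ∀ x, r₂ x = 0 ∨ r₂ x = 1) (h0₁ : ∀ x ∉ Ω, r₁ x = 0) (h0₂ : ∀ x ∉ Ω, r₂ x = 0)
    (hρ₁ : ρ₁ =ᵐ[volume.restrict Ω] r₁) (hρ₂ : ρ₂ =ᵐ[volume.restrict Ω] r₂)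
    {ζ : Space d → ℝ} (hζ : ContinuousOn ζ Ω) {C : ℝ} (hζC : ∀ x ∈ Ω, |ζ x| ≤ C)
    {ε : ℝ} (hε : 0 < ε) :
    Integrable (fun z => J z * interactionQuotient ζ r₁ r₂ ε z) ∧
    ∫ x in Ω, ζ x * (ρ₁ x * kernelConvolution Ω J ε ρ₂ x) =
      ∫ z, J z * interactionQuotient ζ r₁ r₂ ε z := by
  have hf : Integrable fun x => ζ x * r₁ x := by
    have h1 : IntegrableOn (fun x => ζ x * r₁ x) Ω :=
      hi₁.integrableOn.bdd_mul (c := C) (hζ.aestronglyMeasurable hΩo.measurableSet)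
        ((ae_restrict_mem hΩo.measurableSet).mono hζC)
    refine (integrableOn_iff_integrable_of_support_subset fun x hx => ?_).1 h1
    by_contra h
    exact hx (by simp [h0₁ x h])
  have hprod : Integrable (fun p : Space d × Space d =>
      J p.1 * (ε⁻¹ * (ζ p.2 * (r₁ p.2 * r₂ (p.2 - ε • p.1))))) (volume.prod volume) := by
    have h1 := ((hJ.mul_prod hf).mul_bdd (c := 1)
      (g := fun p : Space d × Space d => r₂ (p.2 - ε • p.1))
      (Measurable.aestronglyMeasurable (by fun_prop))
      (ae_of_all _ fun p => by rcases h₂ (p.2 - ε • p.1) with h | h <;> simp [h])).const_mul ε⁻¹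
    refine h1.congr (ae_of_all _ fun p => ?_)
    ring
  have hJa : ∀ z, J z * interactionQuotient ζ r₁ r₂ ε z =
      ∫ x, J z * (ε⁻¹ * (ζ x * (r₁ x * r₂ (x - ε • z)))) := fun z => by
    rw [integral_const_mul, integral_const_mul, interactionQuotient]
  simp only [hJa]
  refine ⟨hprod.integral_prod_left, ?_⟩
  rw [integral_integral_swap hprod]
  have h1 : ∫ x in Ω, ζ x * (ρ₁ x * kernelConvolution Ω J ε ρ₂ x) =
      ∫ x in Ω, ζ x * (r₁ x * kernelConvolution Ω J ε ρ₂ x) := by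
    refine integral_congr_ae ?_
    filter_upwards [hρ₁] with x hx
    rw [hx]
  rw [h1, setIntegral_eq_integral_of_forall_compl_eq_zero fun x hx => by simp [h0₁ x hx]]
  congr 1
  ext x
  rw [kernelConvolution_eq hΩo J h0₂ hρ₂ hε, ← integral_const_mul, ← integral_const_mul,
    ← integral_const_mul]
  congr 1
  ext z
  ring

theorem setIntegral_sigmaMeasure_eq {d : ℕ} {Ω : Set (Space d)} (hΩo : IsOpen Ω)
    {J : Space d → ℝ} (hJm : Measurable J) (hJ0 : ∀ z, 0 ≤ J z)
    (hJ : Integrable fun z => J z * ‖z‖) {ρ : Space d → ℝ}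
    {ν : VectorMeasure (Space d) (Space d)} (hν : IsGradientMeasure Ω ρ ν)
    {ζ : Space d → ℝ} (hζ : ContinuousOn ζ Ω) {C : ℝ} (hζC : ∀ x ∈ Ω, |ζ x| ≤ C) :
    Integrable (fun z => J z * ∫ x, ζ x * |inner ℝ z (polarDensity ν x)| ∂ν.variation) ∧
    ∫ x in Ω, ζ x ∂(sigmaMeasure J ν) =
      ∫ z, J z * ∫ x, ζ x * |inner ℝ z (polarDensity ν x)| ∂ν.variation := by
  have : IsFiniteMeasure ν.variation := ⟨hν.1⟩
  have hmem : ∀ᵐ x ∂ν.variation, x ∈ Ω := by rw [ae_iff]; exact hν.2.1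
  have hres : ν.variation.restrict Ω = ν.variation := Measure.restrict_eq_self_of_ae_mem hmem
  have hζb : ∀ᵐ x ∂ν.variation, |ζ x| ≤ C := hmem.mono hζC
  have hζm : AEStronglyMeasurable ζ ν.variation := by
    rw [← hres]
    exact hζ.aestronglyMeasurable hΩo.measurableSet
  have hpm := measurable_polarDensity ν
  constructor
  · have hprod : Integrable (fun p : Space d × Space d =>
        ζ p.2 * (J p.1 * |inner ℝ p.1 (polarDensity ν p.2)|)) (volume.prod ν.variation) := by
      have h0 : ∀ᵐ p ∂((volume : Measure (Space d)).prod ν.variation), |ζ p.2| ≤ C :=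
        Measure.quasiMeasurePreserving_snd.ae hζb
      refine Integrable.bdd_mul (c := C) ?_ hζm.comp_snd h0
      refine (hJ.mul_prod (integrable_polarDensity ν).norm).mono'
        (Measurable.aestronglyMeasurable (by fun_prop)) (ae_of_all _ fun p => ?_)
      rw [Real.norm_of_nonneg (mul_nonneg (hJ0 _) (abs_nonneg _)), mul_assoc]
      exact mul_le_mul_of_nonneg_left (abs_real_inner_le_norm _ _) (hJ0 _)
    refine hprod.integral_prod_left.congr (ae_of_all _ fun z => ?_)
    simp only
    rw [← integral_const_mul]
    congr 1
    ext x
    ring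
  · have hres' : (sigmaMeasure J ν).restrict Ω = sigmaMeasure J ν := by
      rw [sigmaMeasure, restrict_withDensity hΩo.measurableSet, hres]
    rw [hres']
    exact integral_sigmaMeasure hJm hJ0 hJ ν hν.1 hζm hζb

theorem mainTheorem5 {d : ℕ} (Ω : Set (Space d)) (hΩo : IsOpen Ω) (hΩc : Convex ℝ Ω)
    (hΩb : Bornology.IsBounded Ω)
    (ρ₁ ρ₂ : Space d → ℝ) (hρ₁ : IsBVZeroOne Ω ρ₁) (hρ₂ : IsBVZeroOne Ω ρ₂)
    (hdisj : ∀ᵐ x ∂volume.restrict Ω, ρ₁ x * ρ₂ x = 0)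
    (ζ : Space d → ℝ) (hζ : ContDiffOn ℝ ∞ ζ Ω) (hζb : ∃ C : ℝ, ∀ x ∈ Ω, |ζ x| ≤ C)
    (J : Space d → ℝ) (hJm : Measurable J) (hJ0 : ∀ z, 0 ≤ J z) (hJe : ∀ z, J (-z) = J z)
    (hJd : HasRapidDecay J) :
    Tendsto (fun ε : ℝ => ∫ x in Ω, ζ x * (ρ₁ x * kernelConvolution Ω J ε ρ₂ x))
      (𝓝[>] 0)
      (𝓝 ((1 / 4) * ((∫ x in Ω, ζ x ∂(sigmaMeasure J (gradientMeasure Ω ρ₁))) +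
            ∫ x in Ω, ζ x ∂(sigmaMeasure J (gradientMeasure Ω ρ₂))) -
          (1 / 4) * ∫ x in Ω, ζ x ∂(sigmaMeasure J (gradientMeasure Ω (ρ₁ + ρ₂))))) := by
  obtain ⟨C', hC'⟩ := hζb
  set C := |C'|
  have hC : 0 ≤ C := abs_nonneg _
  have hζC : ∀ x ∈ Ω, |ζ x| ≤ C := fun x hx => (hC' x hx).trans (le_abs_self _)
  obtain ⟨r₁, r₂, hm₁, hm₂, h₁, h₂, h₁₂, h0₁, h0₂, e₁, e₂⟩ :=
    hρ₁.exists_disjoint_representatives hΩo hρ₂ hdisj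
  have hint : ∀ {ρ r : Space d → ℝ}, IsBVZeroOne Ω ρ → (∀ x ∉ Ω, r x = 0) →
      ρ =ᵐ[volume.restrict Ω] r → Integrable r := by
    intro ρ r hρ h0 e
    refine (integrableOn_iff_integrable_of_support_subset fun x hx => ?_).1 (hρ.1.1.congr e)
    by_contra h
    exact hx (h0 x h)
  have hi₁ := hint hρ₁ h0₁ e₁
  have hi₂ := hint hρ₂ h0₂ e₂
  have hν₁ := hρ₁.1.isGradientMeasure.congr e₁
  have hν₂ := hρ₂.1.isGradientMeasure.congr e₂
  have hν := (hρ₁.1.add hρ₂.1).isGradientMeasure.congr (e₁.add e₂)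
  have hJi := hJd.integrable hJm hJ0
  have hJn := hJd.integrable_mul_norm hJm hJ0
  obtain ⟨I₁, s₁⟩ := setIntegral_sigmaMeasure_eq hΩo hJm hJ0 hJn hν₁ hζ.continuousOn hζC
  obtain ⟨I₂, s₂⟩ := setIntegral_sigmaMeasure_eq hΩo hJm hJ0 hJn hν₂ hζ.continuousOn hζC
  obtain ⟨I, s⟩ := setIntegral_sigmaMeasure_eq hΩo hJm hJ0 hJn hν hζ.continuousOn hζC
  rw [s₁, s₂, s]
  set S₁ : Space d → ℝ := fun z => ∫ x, ζ x * |inner ℝ z (polarDensity (gradientMeasure Ω ρ₁) x)|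
    ∂(gradientMeasure Ω ρ₁).variation
  set S₂ : Space d → ℝ := fun z => ∫ x, ζ x * |inner ℝ z (polarDensity (gradientMeasure Ω ρ₂) x)|
    ∂(gradientMeasure Ω ρ₂).variation
  set S : Space d → ℝ := fun z =>
    ∫ x, ζ x * |inner ℝ z (polarDensity (gradientMeasure Ω (ρ₁ + ρ₂)) x)|
      ∂(gradientMeasure Ω (ρ₁ + ρ₂)).variation
  have hlimit : 1 / 4 * ((∫ z, J z * S₁ z) + ∫ z, J z * S₂ z) - 1 / 4 * ∫ z, J z * S z =
      ∫ z, 1 / 2 * (J z * (1 / 2 * (S₁ z + S₂ z - S z))) := by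
    have i₁₂ : Integrable fun z => J z * S₁ z + J z * S₂ z := I₁.add I₂
    rw [← integral_add I₁ I₂, ← mul_sub, ← integral_sub i₁₂ I, ← integral_const_mul]
    congr 1
    ext z
    ring
  rw [hlimit]
  have hconv := fun {ε : ℝ} (hε : 0 < ε) => integral_kernelConvolution_eq hΩo hJi hm₂ hi₁ h₂
    h0₁ h0₂ e₁ e₂ hζ.continuousOn hζC hε
  have hsymm : ∀ᶠ ε in 𝓝[>] (0 : ℝ),
      ∫ z, 1 / 2 * (J z * (interactionQuotient ζ r₁ r₂ ε z + interactionQuotient ζ r₁ r₂ ε (-z))) =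
        ∫ x in Ω, ζ x * (ρ₁ x * kernelConvolution Ω J ε ρ₂ x) := by
    filter_upwards [self_mem_nhdsWithin] with ε (hε : 0 < ε)
    obtain ⟨hI, he⟩ := hconv hε
    have hI' : Integrable fun z => J z * interactionQuotient ζ r₁ r₂ ε (-z) := by
      simpa [hJe] using hI.comp_neg
    have he' : ∫ z, J z * interactionQuotient ζ r₁ r₂ ε (-z) =
        ∫ z, J z * interactionQuotient ζ r₁ r₂ ε z := by
      rw [← integral_neg_eq_self fun z => J z * interactionQuotient ζ r₁ r₂ ε z]
      simp only [hJe]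
    simp only [mul_add (J _)]
    rw [he, integral_const_mul, integral_add hI hI', he']
    ring
  refine Tendsto.congr' hsymm ?_
  set M := ∫ x, ‖polarDensity (gradientMeasure Ω ρ₁) x‖ ∂(gradientMeasure Ω ρ₁).variation
  refine tendsto_integral_filter_of_dominated_convergence
    (fun z => C * M * (J z * ‖z‖)) ?_ ?_ (hJn.const_mul _) (ae_of_all _ fun z => ?_)
  · filter_upwards [self_mem_nhdsWithin] with ε (hε : 0 < ε)
    obtain ⟨hI, -⟩ := hconv hε
    have hI' : Integrable fun z => J z * interactionQuotient ζ r₁ r₂ ε (-z) := by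
      simpa [hJe] using hI.comp_neg
    simp only [mul_add (J _)]
    exact ((hI.add hI').const_mul _).aestronglyMeasurable
  · filter_upwards [self_mem_nhdsWithin] with ε (hε : 0 < ε)
    refine ae_of_all _ fun z => ?_
    have b₁ := abs_interactionQuotient_le hΩo hΩc hm₁ hi₁ h₁ h₂ h₁₂ h0₁ h0₂ hν₁ hC hζC hε z
    have b₂ := abs_interactionQuotient_le hΩo hΩc hm₁ hi₁ h₁ h₂ h₁₂ h0₁ h0₂ hν₁ hC hζC hε (-z)
    rw [norm_neg] at b₂
    have b₃ := (abs_add_le _ _).trans (add_le_add b₁ b₂)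
    rw [norm_mul, norm_mul, Real.norm_of_nonneg (hJ0 z), Real.norm_of_nonneg (by norm_num),
      Real.norm_eq_abs]
    have := mul_le_mul_of_nonneg_left b₃ (hJ0 z)
    linarith
  · exact ((tendsto_interactionQuotient_add_neg hΩo hΩc hm₁ hm₂ hi₁ hi₂ h₁ h₂ h₁₂ h0₁ h0₂
      hν₁ hν₂ hν hζ hC hζC z).const_mul (J z)).const_mul (1 / 2)
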